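/- Let $N$ be an $\mathbb N_0$-valued random variable that is nondegenerate (not almost surely constant) and satisfies $P(N=0)=0$ and $E[N\log N]<\infty$. Put $a:=E[N]>1$ and $\mu:=\min\{n : P(N=n)>0\}\ge 1$. Let $T$ be the Galton--Watson tree with offspring law that of $N$, constructed from an i.i.d. family of offspring numbers with the law of $N$ (one for each potential vertex) as a random rooted ordered (plane) tree. Let $Z_n$ be the number of vertices of $T$ in generation $n$ ($Z_0=1$), and let $W:=\lim_{n\to\infty}Z_n/a^n$, the limit existing almost surely. Let $\mathcal T$ be the space of rooted ordered trees in which every vertex has finite degree, with the metric $d(T_1,T_2)=e^{-n}$ for $T_1\neq T_2$, where $n$ is maximal such that $T_1$ and $T_2$ coincide up to generation $n$ (and $d(T_1,T_1)=0$), and its Borel $\sigma$-algebra. Then $P(W<\varepsilon)>0$ for every $\varepsilon>0$ and, both for $\mu=1$ and for $\mu\ge2$, as $\varepsilon\downarrow0$ the conditional law of $T$ given $\{W<\varepsilon\}$ converges weakly on $(\mathcal T,d)$ to the unit mass at the regular $\mu$-ary tree, i.e. the tree in which every vertex has exactly $\mu$ offspring. Equivalently, $$\lim_{\varepsilon\downarrow0}P\big(Z_k=\mu^k\,\big|\,W<\varepsilon\big)=1\qquad\text{for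 every fixed }k\in\mathbb N_0.$$ -/

import Mathlib

open MeasureTheory ProbabilityTheory Filter Topology

/-- A locally finite rooted (plane) tree, in the Ulam-Harris encoding. The root is the empty list;
the vertex `i :: v` is the child number `i` (counted from `0`) of the vertex `v`, and the length
of the list is the generation of the vertex. -/
@[ext]
structure PlaneTree where
  /-- the set of vertices -/
  verts : Set (List ℕ)
  root_mem : [] ∈ verts
  parent_mem : ∀ (i : ℕ) (v : List ℕ), i :: v ∈ verts → v ∈ verts
  sibling_mem : ∀ (i j : ℕ) (v : List ℕ), j ≤ i → i :: v ∈ verts → j :: v ∈ verts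
  finite_children : ∀ v : List ℕ, {i : ℕ | i :: v ∈ verts}.Finite

namespace PlaneTree

/-- The two trees coincide up to generation `n`. -/
def AgreeUpTo (n : ℕ) (S T : PlaneTree) : Prop :=
  ∀ v : List ℕ, v.length ≤ n → (v ∈ S.verts ↔ v ∈ T.verts)

theorem agreeUpTo_zero (S T : PlaneTree) : AgreeUpTo 0 S T := by
  intro v hv
  have h : v = [] := List.length_eq_zero_iff.mp (Nat.le_zero.mp hv)
  subst h
  exact iff_of_true S.root_mem T.root_mem

theorem AgreeUpTo.mono {m n : ℕ} {S T : PlaneTree} (h : AgreeUpTo n S T) (hmn : m ≤ n) :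
    AgreeUpTo m S T := fun v hv => h v (hv.trans hmn)

theorem bddAbove_agreeUpTo {S T : PlaneTree} (h : S ≠ T) :
    BddAbove {n : ℕ | AgreeUpTo n S T} := by
  by_contra hb
  apply h
  ext v
  rw [not_bddAbove_iff] at hb
  obtain ⟨n, hn, hlt⟩ := hb v.length
  exact hn v hlt.le

open Classical in
/-- `d(S, T) = exp (-n)`, where `n` is maximal such that `S` and `T` coincide up to
generation `n` (and `d(S, S) = 0`). -/
noncomputable instance : Dist PlaneTree where
  dist S T := if S = T then 0 else Real.exp (-((sSup {n : ℕ | AgreeUpTo n S T} : ℕ) : ℝ))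

theorem dist_eq_of_ne {S T : PlaneTree} (h : S ≠ T) :
    dist S T = Real.exp (-((sSup {n : ℕ | AgreeUpTo n S T} : ℕ) : ℝ)) := if_neg h

theorem agreeUpTo_sSup {S T : PlaneTree} (h : S ≠ T) :
    AgreeUpTo (sSup {n : ℕ | AgreeUpTo n S T}) S T :=
  Nat.sSup_mem ⟨0, agreeUpTo_zero S T⟩ (bddAbove_agreeUpTo h)

theorem dist_le_exp_iff {S T : PlaneTree} (n : ℕ) :
    dist S T ≤ Real.exp (-(n : ℝ)) ↔ AgreeUpTo n S T := by
  by_cases h : S = T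
  · subst h
    refine iff_of_true ?_ (fun v _ => Iff.rfl)
    have : dist S S = 0 := if_pos rfl
    rw [this]
    positivity
  · rw [dist_eq_of_ne h, Real.exp_le_exp, neg_le_neg_iff, Nat.cast_le]
    exact ⟨fun hn => (agreeUpTo_sSup h).mono hn, fun hn => le_csSup (bddAbove_agreeUpTo h) hn⟩

noncomputable instance : MetricSpace PlaneTree where
  dist_self S := if_pos rfl
  dist_comm S T := by
    by_cases h : S = T
    · rw [h]
    · have hset : {n : ℕ | AgreeUpTo n S T} = {n : ℕ | AgreeUpTo n T S} := by
        ext n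
        exact ⟨fun hn v hv => (hn v hv).symm, fun hn v hv => (hn v hv).symm⟩
      rw [dist_eq_of_ne h, dist_eq_of_ne (Ne.symm h), hset]
  dist_triangle S T U := by
    have h0 : ∀ A B : PlaneTree, 0 ≤ dist A B := by
      intro A B
      by_cases h : A = B
      · exact (if_pos h : dist A B = 0).ge
      · rw [dist_eq_of_ne h]
        positivity
    by_cases h1 : S = T
    · subst h1
      linarith [h0 S S]
    by_cases h2 : T = U
    · subst h2
      linarith [h0 T T]
    have a1 := agreeUpTo_sSup h1
    have a2 := agreeUpTo_sSup h2
    rcases le_total (sSup {n : ℕ | AgreeUpTo n S T}) (sSup {n : ℕ | AgreeUpTo n T U}) with h | h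
    · have := (dist_le_exp_iff _).mpr
        (fun v hv => (a1 v hv).trans (a2.mono h v hv) : AgreeUpTo _ S U)
      rw [← dist_eq_of_ne h1] at this
      linarith [h0 T U]
    · have := (dist_le_exp_iff _).mpr
        (fun v hv => (a1.mono h v hv).trans (a2 v hv) : AgreeUpTo _ S U)
      rw [← dist_eq_of_ne h2] at this
      linarith [h0 S T]
  eq_of_dist_eq_zero := by
    intro S T h
    by_contra hne
    rw [dist_eq_of_ne hne] at h
    exact (Real.exp_pos _).ne' h

/-- The Borel sigma-algebra of the metric. -/
noncomputable instance : MeasurableSpace PlaneTree := borel PlaneTree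

instance : BorelSpace PlaneTree := ⟨rfl⟩

/-- The vertices of generation `n`. -/
def generation (T : PlaneTree) (n : ℕ) : Set (List ℕ) := {v | v ∈ T.verts ∧ v.length = n}

theorem finite_generation (T : PlaneTree) (n : ℕ) : (T.generation n).Finite := by
  induction n with
  | zero =>
    refine (Set.finite_singleton ([] : List ℕ)).subset ?_
    rintro v ⟨-, hv⟩
    exact List.length_eq_zero_iff.mp hv
  | succ n ih =>
    refine (ih.biUnion (fun v _ => (T.finite_children v).image (fun i => i :: v))).subset ?_
    rintro v ⟨hv, hlen⟩
    cases v with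
    | nil => simp at hlen
    | cons i v =>
      simp only [Set.mem_iUnion]
      exact ⟨v, ⟨T.parent_mem i v hv, by simpa using hlen⟩, i, hv, rfl⟩

/-- The number of vertices of generation `n`. -/
noncomputable def genSize (T : PlaneTree) (n : ℕ) : ℕ := (T.generation n).ncard

/-- Membership of a vertex in the tree in which each vertex `v` has `c v` children. -/
def MemOfOffspring (c : List ℕ → ℕ) : List ℕ → Prop
  | [] => True
  | i :: v => MemOfOffspring c v ∧ i < c v

/-- The tree in which each vertex `v` has exactly `c v` children. -/
def ofOffspring (c : List ℕ → ℕ) : PlaneTree where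
  verts := {v | MemOfOffspring c v}
  root_mem := trivial
  parent_mem _ _ h := h.1
  sibling_mem _ _ _ hji h := ⟨h.1, hji.trans_lt h.2⟩
  finite_children v := (Set.finite_Iio (c v)).subset fun _ h => h.2

/-- The regular `m`-ary tree: every vertex has exactly `m` offspring. -/
def regular (m : ℕ) : PlaneTree := ofOffspring fun _ => m

end PlaneTree

namespace GaltonWatson

/-- The mean `a = E N` of the offspring law. -/
noncomputable def meanOffspring (ν : Measure ℕ) : ℝ := ∫ n, (n : ℝ) ∂ν

/-- The minimal offspring number `μ = min {n : P(N = n) > 0}`. -/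
noncomputable def minOffspring (ν : Measure ℕ) : ℕ := sInf {n : ℕ | 0 < ν {n}}

/-- The random tree generated by the offspring variables `ξ v`, one for each potential
vertex `v`. -/
def tree {Ω : Type*} (ξ : List ℕ → Ω → ℕ) (ω : Ω) : PlaneTree :=
  PlaneTree.ofOffspring fun v => ξ v ω

/-- The generation sizes `Z n` of the random tree. -/
noncomputable def Z {Ω : Type*} (ξ : List ℕ → Ω → ℕ) (n : ℕ) (ω : Ω) : ℕ :=
  (tree ξ ω).genSize n

/-- The martingale limit `W = lim Z n / a ^ n`. -/
noncomputable def W {Ω : Type*} (ν : Measure ℕ) (ξ : List ℕ → Ω → ℕ) (ω : Ω) : ℝ :=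
  limUnder atTop fun n : ℕ => (Z ξ n ω : ℝ) / meanOffspring ν ^ n

end GaltonWatson

/-!
Write `m` for the minimal offspring number, `a` for the mean, `F x = P(W < x)` and
`G x = P(W₀ + ⋯ + W_{m-1} < x)` for independent copies `Wᵢ` of `W`. Decomposing the tree at the root
gives `W = a⁻¹ (W₀ + ⋯ + W_{N-1})`, where `N` is the offspring number of the root. If `W < ε` and
`N > m`, then both `W₀ + ⋯ + W_{m-1} < a ε` and `W_m < a ε`, so that
`P(N ≠ m, W < ε) ≤ G (a ε) F (a ε)`, whereas `F ε ≥ P(N = m) G (a ε)`. Hence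
`P(N ≠ m | W < ε) ≤ F (a ε) / P(N = m)`, which tends to `0` because `P(W = 0) = 0`
(`measure_root_ne_le`, `measure_sum_lt_le`). This settles the first generation. The later ones
follow by induction: given that `N = m`, each of the `m` subtrees at the children of the root is
conditioned on the smallness of its own limit plus an independent nonnegative variable, and
conditioning on the value of the latter leaves the induction hypothesis
(`measure_mem_and_add_lt_le`, `exists_measure_not_regularUpTo_le`).

It remains to see that `W` exists, that `P(W = 0) = 0` and that `F ε > 0` for `ε > 0`. Existence is
martingale convergence (`ae_tendsto_limitSize`). Positivity of `F` follows from
`F ε ≥ P(N = m) F (a ε / m) ^ m` and `a > m` (`measure_limitSize_lt_pos`). The `N log N` condition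
enters in `P(W = 0) = 0`, the relevant half of the Kesten-Stigum theorem. With `φₙ` the Laplace
transform of `Zₙ / a ^ n` and `f` the generating function of `N`, one has
`φₙ₊₁ s = f (φₙ (s / a))`. Linearizing `f` at `1` shows that the quotients
`a ^ k (1 - φₙ (a ^ (-k)))` lose at most `E (a ^ (-(k + 1))) / a` in each step, where
`E y = 𝔼 min (N, N² y)`, and `∑ E (a ^ (-k))` is finite precisely thanks to the moment condition
(`summable_linearizationError`). So the limit of `φₙ` is not identically `1`, and `P(W = 0) < 1`
(`not_ae_limitSize_eq_zero`). As `P(W = 0)` is a fixed point of `f` and `P(N = 0) = 0`, it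
vanishes (`ae_limitSize_pos`).

All of this is done on the canonical space `List ℕ → ℕ` of offspring numbers with the product
measure `offspringLaw ν`, on which the branching property is a statement about product measures
(`measurePreserving_root_subOffspring`).
-/

/-! ### Offspring families and their trees -/

namespace PlaneTree

/-- The offspring numbers seen from the `i`-th child of the root. In the Ulam-Harris encoding of
`PlaneTree` the last entry of a list is the first step away from the root, so the descendants of the
`i`-th child of the root are the lists `v ++ [i]`. -/
def subOffspring (i : ℕ) (c : List ℕ → ℕ) : List ℕ → ℕ := fun v => c (v ++ [i])

/-- The size of the `n`-th generation of the tree with offspring numbers `c`. -/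
noncomputable def treeSize (n : ℕ) (c : List ℕ → ℕ) : ℕ := (ofOffspring c).genSize n

theorem memOfOffspring_append (c : List ℕ → ℕ) (i : ℕ) (v : List ℕ) :
    MemOfOffspring c (v ++ [i]) ↔ i < c [] ∧ MemOfOffspring (subOffspring i c) v := by
  induction v with
  | nil => simp [MemOfOffspring]
  | cons j v ih => simp only [List.cons_append, MemOfOffspring, ih, subOffspring]; tauto

theorem genSize_eq_card (T : PlaneTree) (n : ℕ) :
    T.genSize n = (T.finite_generation n).toFinset.card :=
  Set.ncard_eq_toFinset_card _ _

theorem mem_generation_ofOffspring {c : List ℕ → ℕ} {n : ℕ} {v : List ℕ} :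
    v ∈ (ofOffspring c).generation n ↔ MemOfOffspring c v ∧ v.length = n := Iff.rfl

theorem treeSize_zero (c : List ℕ → ℕ) : treeSize 0 c = 1 := by
  have : (ofOffspring c).generation 0 = {[]} := by
    ext v
    rw [mem_generation_ofOffspring, List.length_eq_zero_iff, Set.mem_singleton_iff]
    exact ⟨fun h => h.2, fun h => ⟨h ▸ trivial, h⟩⟩
  rw [treeSize, genSize, this, Set.ncard_singleton]

/-- Decomposition of a generation according to the child of the root its vertices descend from. -/
theorem treeSize_succ (n : ℕ) (c : List ℕ → ℕ) :
    treeSize (n + 1) c = ∑ i ∈ Finset.range (c []), treeSize n (subOffspring i c) := by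
  classical
  have h : ((ofOffspring c).finite_generation (n + 1)).toFinset =
      (Finset.range (c [])).biUnion fun i =>
        ((ofOffspring (subOffspring i c)).finite_generation n).toFinset.image (· ++ [i]) := by
    ext v
    simp only [Set.Finite.mem_toFinset, Finset.mem_biUnion, Finset.mem_range, Finset.mem_image,
      mem_generation_ofOffspring]
    constructor
    · rintro ⟨hv, hl⟩
      rcases List.eq_nil_or_concat' v with rfl | ⟨w, i, rfl⟩
      · simp at hl
      · rw [memOfOffspring_append] at hv
        exact ⟨i, hv.1, w, ⟨hv.2, by simpa using hl⟩, rfl⟩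
    · rintro ⟨i, hi, w, ⟨hw, hl⟩, rfl⟩
      exact ⟨(memOfOffspring_append c i w).2 ⟨hi, hw⟩, by simpa using hl⟩
  rw [treeSize, genSize_eq_card, h, Finset.card_biUnion]
  · refine Finset.sum_congr rfl fun i _ => ?_
    rw [Finset.card_image_of_injective _ (List.append_left_injective [i]), treeSize,
      genSize_eq_card]
  · intro i _ j _ hij
    rw [Function.onFun, Finset.disjoint_left]
    intro v hi hj
    simp only [Finset.mem_image] at hi hj
    obtain ⟨w, -, rfl⟩ := hi
    obtain ⟨w', -, h'⟩ := hj
    exact hij (by simpa using (List.append_inj' h' rfl).2.symm)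

open Classical in
theorem tsum_generation (n : ℕ) (c : List ℕ → ℕ) (f : List ℕ → ENNReal) :
    ∑' v : {v : List ℕ // v.length = n}, (if MemOfOffspring c v then f v else 0) =
      ∑ v ∈ ((ofOffspring c).finite_generation n).toFinset, f v := by
  refine (tsum_subtype {v : List ℕ | v.length = n}
    fun v => if MemOfOffspring c v then f v else 0).trans ?_
  rw [tsum_eq_sum (s := ((ofOffspring c).finite_generation n).toFinset)]
  · refine Finset.sum_congr rfl fun v hv => ?_
    rw [Set.Finite.mem_toFinset, mem_generation_ofOffspring] at hv
    rw [Set.indicator_of_mem (by exact hv.2), if_pos hv.1]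
  · intro v hv
    rw [Set.Finite.mem_toFinset, mem_generation_ofOffspring] at hv
    by_cases hl : v.length = n
    · rw [Set.indicator_of_mem (by exact hl), if_neg fun h => hv ⟨h, hl⟩]
    · exact Set.indicator_of_notMem (s := {v : List ℕ | v.length = n}) hl _

open Classical in
theorem treeSize_eq_tsum (n : ℕ) (c : List ℕ → ℕ) :
    (treeSize n c : ENNReal) =
      ∑' v : {v : List ℕ // v.length = n}, if MemOfOffspring c v then 1 else 0 := by
  rw [tsum_generation n c fun _ => 1, treeSize, genSize_eq_card, Finset.card_eq_sum_ones,
    Nat.cast_sum, Nat.cast_one]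

open Classical in
/-- Decomposition of a generation according to the parents of its vertices. -/
theorem treeSize_succ_eq_tsum (n : ℕ) (c : List ℕ → ℕ) :
    (treeSize (n + 1) c : ENNReal) =
      ∑' v : {v : List ℕ // v.length = n}, if MemOfOffspring c v then (c v : ENNReal) else 0 := by
  have h : ((ofOffspring c).finite_generation (n + 1)).toFinset =
      ((ofOffspring c).finite_generation n).toFinset.biUnion fun v =>
        (Finset.range (c v)).image (· :: v) := by
    ext v
    simp only [Set.Finite.mem_toFinset, Finset.mem_biUnion, Finset.mem_range, Finset.mem_image,
      mem_generation_ofOffspring]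
    constructor
    · rintro ⟨hv, hl⟩
      cases v with
      | nil => simp at hl
      | cons i v => exact ⟨v, ⟨hv.1, by simpa using hl⟩, i, hv.2, rfl⟩
    · rintro ⟨v, ⟨hv, hl⟩, i, hi, rfl⟩
      exact ⟨⟨hv, hi⟩, by simpa using hl⟩
  have hsum : treeSize (n + 1) c =
      ∑ v ∈ ((ofOffspring c).finite_generation n).toFinset, c v := by
    rw [treeSize, genSize_eq_card, h, Finset.card_biUnion]
    · refine Finset.sum_congr rfl fun v _ => ?_
      rw [Finset.card_image_of_injective _ (fun i j hij => (List.cons.inj hij).1),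
        Finset.card_range]
    · intro v _ w _ hvw
      rw [Function.onFun, Finset.disjoint_left]
      intro u hv hw
      simp only [Finset.mem_image] at hv hw
      obtain ⟨i, -, rfl⟩ := hv
      obtain ⟨j, -, h'⟩ := hw
      exact hvw (List.cons.inj h').2.symm
  rw [tsum_generation n c fun v => c v, hsum, Nat.cast_sum]

/-- The tree with offspring numbers `c` has the shape of the regular `m`-ary tree up to
generation `k`. -/
def RegularUpTo (m k : ℕ) (c : List ℕ → ℕ) : Prop := AgreeUpTo k (ofOffspring c) (regular m)

theorem regularUpTo_zero (m : ℕ) (c : List ℕ → ℕ) : RegularUpTo m 0 c := agreeUpTo_zero _ _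

theorem RegularUpTo.succ {m k : ℕ} {c : List ℕ → ℕ} (h0 : c [] = m)
    (h : ∀ i < m, RegularUpTo m k (subOffspring i c)) : RegularUpTo m (k + 1) c := by
  intro v hv
  rcases List.eq_nil_or_concat' v with rfl | ⟨w, i, rfl⟩
  · exact iff_of_true trivial trivial
  · change MemOfOffspring c (w ++ [i]) ↔ MemOfOffspring (fun _ => m) (w ++ [i])
    rw [memOfOffspring_append, memOfOffspring_append, h0]
    exact and_congr_right fun hi => h i hi w (by simpa using hv)

theorem genSize_regular (m k : ℕ) : (regular m).genSize k = m ^ k := by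
  change treeSize k (fun _ => m) = m ^ k
  induction k with
  | zero => rw [treeSize_zero, pow_zero]
  | succ k ih =>
    have : ∀ i, subOffspring i (fun _ => m) = fun _ => m := fun i => rfl
    simp only [treeSize_succ, this, ih, Finset.sum_const, Finset.card_range, smul_eq_mul, pow_succ']

theorem RegularUpTo.treeSize_eq {m k : ℕ} {c : List ℕ → ℕ} (h : RegularUpTo m k c) :
    treeSize k c = m ^ k := by
  have : (ofOffspring c).generation k = (regular m).generation k := by
    ext v
    exact and_congr_left fun hv => h v hv.le
  rw [← genSize_regular, treeSize, genSize, genSize, this]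

/-- The tree depends continuously on the offspring numbers (in the product topology): its first
`n` generations are determined by the offspring numbers of finitely many of its vertices. -/
theorem continuous_ofOffspring : Continuous ofOffspring := by
  rw [continuous_iff_continuousAt]
  intro c₀
  rw [ContinuousAt, Metric.tendsto_nhds]
  intro ε hε
  obtain ⟨n, hn⟩ : ∃ n : ℕ, Real.exp (-(n : ℝ)) < ε :=
    ((Real.tendsto_exp_neg_atTop_nhds_zero.comp tendsto_natCast_atTop_atTop).eventually
      (gt_mem_nhds hε)).exists
  have hfin : (⋃ k ∈ Set.Iio n, (ofOffspring c₀).generation k).Finite :=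
    (Set.finite_Iio n).biUnion fun k _ => (ofOffspring c₀).finite_generation k
  have hev : ∀ᶠ c : List ℕ → ℕ in 𝓝 c₀,
      ∀ v ∈ ⋃ k ∈ Set.Iio n, (ofOffspring c₀).generation k, c v = c₀ v := by
    rw [eventually_all_finite hfin]
    intro v _
    have := (continuous_apply (A := fun _ : List ℕ => ℕ) v).tendsto c₀
    -- `ℕ` is discrete, so coordinates are locally constant.
    rw [nhds_discrete ℕ, tendsto_pure] at this
    exact this
  filter_upwards [hev] with c hc
  refine ((dist_le_exp_iff n).2 ?_).trans_lt hn
  intro v hv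
  change MemOfOffspring c v ↔ MemOfOffspring c₀ v
  induction v with
  | nil => exact Iff.rfl
  | cons i v ih =>
    have hl : v.length < n := by simpa using hv
    rw [MemOfOffspring, MemOfOffspring, ih hl.le]
    refine and_congr_right fun hmem => ?_
    rw [hc v (Set.mem_biUnion (show v.length ∈ Set.Iio n from hl) ⟨hmem, rfl⟩)]

end PlaneTree

/-! ### Independence of the subtrees at the children of the root -/

namespace GaltonWatson

open PlaneTree

/-- The joint law of the offspring numbers of all potential vertices. -/
noncomputable abbrev offspringLaw (ν : Measure ℕ) [IsProbabilityMeasure ν] :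
    Measure (List ℕ → ℕ) := Measure.infinitePi fun _ => ν

/-- The joint law of the offspring families seen from the children of the root. -/
noncomputable abbrev subtreesLaw (ν : Measure ℕ) [IsProbabilityMeasure ν] :
    Measure (ℕ → List ℕ → ℕ) := Measure.infinitePi fun _ => offspringLaw ν

@[fun_prop]
theorem measurable_subOffspring (i : ℕ) : Measurable (subOffspring i) := by
  unfold subOffspring; fun_prop

variable (ν : Measure ℕ) [IsProbabilityMeasure ν]

theorem map_subOffspring : (offspringLaw ν).map (fun c i => subOffspring i c) = subtreesLaw ν := by
  have hinj : Function.Injective fun p : ℕ × List ℕ => p.2 ++ [p.1] := by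
    rintro ⟨i, v⟩ ⟨j, w⟩ h
    obtain ⟨h1, h2⟩ := List.append_inj' h rfl
    simp_all
  have h1 := Measure.map_infinitePi_infinitePi_of_inj (P := fun _ : List ℕ => ν) hinj
  have h2 := Measure.infinitePi_map_curry (fun (_ : ℕ) (_ : List ℕ) => ν)
  rw [← h1, Measure.map_map (by fun_prop) (by fun_prop)] at h2
  exact h2

theorem indepFun_root_subOffspring :
    IndepFun (fun c : List ℕ → ℕ => c []) (fun c i => subOffspring i c) (offspringLaw ν) := by
  have hind : iIndepFun (fun (v : List ℕ) (c : List ℕ → ℕ) => c v) (offspringLaw ν) :=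
    iIndepFun_infinitePi (X := fun _ x => x) (fun _ => measurable_id)
  have hle : ∀ v : List ℕ, MeasurableSpace.comap (fun c : List ℕ → ℕ => c v) inferInstance ≤
      (inferInstance : MeasurableSpace (List ℕ → ℕ)) := fun v => (measurable_pi_apply v).comap_le
  have h := indep_iSup_of_disjoint hle hind (S := {[]}) (T := {[]}ᶜ) disjoint_compl_right
  refine indep_of_indep_of_le_left (indep_of_indep_of_le_right h ?_) ?_
  · rw [← measurable_iff_comap_le]
    refine @measurable_pi_lambda _ _ _ (_) _ _ fun i =>
      @measurable_pi_lambda _ _ _ (_) _ _ fun v => ?_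
    rw [measurable_iff_comap_le]
    exact le_iSup₂_of_le (v ++ [i]) (by simp) le_rfl
  · exact le_iSup₂_of_le [] rfl le_rfl

/-- The branching property: the offspring number of the root and the offspring families seen
from its children are independent, with laws `ν` and `offspringLaw ν`. -/
theorem measurePreserving_root_subOffspring :
    MeasurePreserving (fun c : List ℕ → ℕ => (c [], fun i => subOffspring i c))
      (offspringLaw ν) (ν.prod (subtreesLaw ν)) := by
  refine ⟨by fun_prop, ?_⟩
  have h := (indepFun_iff_map_prod_eq_prod_map_map
    (measurable_pi_apply _).aemeasurable (by fun_prop)).1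
    (indepFun_root_subOffspring ν)
  rw [h, map_subOffspring, Measure.infinitePi_map_eval]

theorem measurePreserving_subOffspring (i : ℕ) :
    MeasurePreserving (subOffspring i) (offspringLaw ν) (offspringLaw ν) := by
  have h := (measurePreserving_eval_infinitePi (fun _ : ℕ => offspringLaw ν) i).comp
    (⟨by fun_prop, map_subOffspring ν⟩ :
      MeasurePreserving (fun c i => subOffspring i c) (offspringLaw ν) (subtreesLaw ν))
  exact h

end GaltonWatson

/-! ### The martingale of normalized generation sizes -/

namespace GaltonWatson

open PlaneTree

/-- The information contained in the offspring numbers of the vertices of generation `< n`. -/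
def generationFiltration :
    Filtration ℕ (inferInstance : MeasurableSpace (List ℕ → ℕ)) where
  seq n := ⨆ v ∈ {v : List ℕ | v.length < n},
    MeasurableSpace.comap (fun c : List ℕ → ℕ => c v) inferInstance
  mono' _ _ hmn := biSup_mono fun _ hv => lt_of_lt_of_le hv hmn
  le' _ := iSup₂_le fun v _ => (measurable_pi_apply v).comap_le

theorem measurable_apply_generationFiltration {n : ℕ} {v : List ℕ} (hv : v.length < n) :
    Measurable[generationFiltration n] fun c : List ℕ → ℕ => c v := by
  rw [measurable_iff_comap_le]
  exact le_iSup₂_of_le (f := fun v (_ : v ∈ {v : List ℕ | v.length < n}) =>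
    MeasurableSpace.comap (fun c : List ℕ → ℕ => c v) inferInstance) v hv le_rfl

theorem measurableSet_memOfOffspring {n : ℕ} {v : List ℕ} (hv : v.length ≤ n) :
    MeasurableSet[generationFiltration n] {c | MemOfOffspring c v} := by
  induction v with
  | nil => exact @MeasurableSet.univ _ (generationFiltration n)
  | cons i v ih =>
    have hv' : v.length < n := by simpa using hv
    exact @MeasurableSet.inter _ (generationFiltration n) _ _ (ih hv'.le)
      (measurable_apply_generationFiltration hv' (measurableSet_Ioi (a := i)))

theorem measurable_treeSize_generationFiltration (n : ℕ) :
    Measurable[generationFiltration n] fun c => (treeSize n c : ENNReal) := by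
  classical
  simp_rw [treeSize_eq_tsum]
  refine @Measurable.tsum _ _ _ (_) _ _ _ _ _ _ _ _ _ _ _ _ fun v => ?_
  exact @Measurable.ite _ _ (_) _ _ _ _ _ (measurableSet_memOfOffspring v.2.le)
    (@measurable_const _ _ _ (_) _) (@measurable_const _ _ _ (_) _)

theorem measurable_treeSize_real_generationFiltration (n : ℕ) :
    Measurable[generationFiltration n] fun c => (treeSize n c : ℝ) := by
  have h := ENNReal.measurable_toReal.comp (measurable_treeSize_generationFiltration n)
  simpa [Function.comp_def] using h

@[fun_prop]
theorem measurable_treeSize_real (n : ℕ) : Measurable fun c => (treeSize n c : ℝ) :=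
  (measurable_treeSize_real_generationFiltration n).mono (generationFiltration.le n) le_rfl

variable (ν : Measure ℕ)

/-- The generation size divided by its expectation. -/
noncomputable def normalizedSize (n : ℕ) (c : List ℕ → ℕ) : ℝ :=
  treeSize n c / meanOffspring ν ^ n

/-- The limit of the normalized generation sizes, as a function of the offspring numbers. -/
noncomputable def limitSize (c : List ℕ → ℕ) : ℝ :=
  limUnder atTop fun n => normalizedSize ν n c

@[fun_prop]
theorem measurable_normalizedSize (n : ℕ) : Measurable (normalizedSize ν n) :=
  (measurable_treeSize_real n).div_const _

@[fun_prop]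
theorem measurable_limitSize : Measurable (limitSize ν) :=
  (StronglyMeasurable.limUnder fun n => (measurable_normalizedSize ν n).stronglyMeasurable).measurable

theorem meanOffspring_nonneg : 0 ≤ meanOffspring ν := integral_nonneg fun n => by positivity

theorem normalizedSize_nonneg (n : ℕ) (c : List ℕ → ℕ) : 0 ≤ normalizedSize ν n c :=
  div_nonneg (Nat.cast_nonneg _) (pow_nonneg (meanOffspring_nonneg ν) n)

theorem normalizedSize_succ (n : ℕ) (c : List ℕ → ℕ) :
    normalizedSize ν (n + 1) c =
      (∑ i ∈ Finset.range (c []), normalizedSize ν n (subOffspring i c)) / meanOffspring ν := by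
  simp only [normalizedSize, treeSize_succ, Nat.cast_sum, ← Finset.sum_div]
  rw [div_div, pow_succ]

theorem lintegral_natCast (hν : Integrable (fun n : ℕ => (n : ℝ)) ν) :
    ∫⁻ n, (n : ENNReal) ∂ν = ENNReal.ofReal (meanOffspring ν) := by
  rw [meanOffspring, ofReal_integral_eq_lintegral_ofReal hν (ae_of_all _ fun n => by positivity)]
  simp

variable [IsProbabilityMeasure ν]

/-- The offspring number of a vertex is independent of the generations above it. -/
theorem lintegral_mem_mul {n : ℕ} {v : List ℕ} (hv : v.length = n) {s : Set (List ℕ → ℕ)}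
    (hs : MeasurableSet[generationFiltration n] s) :
    ∫⁻ c, s.indicator 1 c * (c v : ENNReal) ∂offspringLaw ν =
      offspringLaw ν s * ∫⁻ n, (n : ENNReal) ∂ν := by
  have hind : iIndepFun (fun (v : List ℕ) (c : List ℕ → ℕ) => c v) (offspringLaw ν) :=
    iIndepFun_infinitePi (X := fun _ x => x) (fun _ => measurable_id)
  have h := indep_iSup_of_disjoint (fun v => (measurable_pi_apply v).comap_le) hind
    (S := {v | v.length < n}) (T := {v}) (by simp [hv])
  simp only [Set.mem_singleton_iff, iSup_iSup_eq_left] at h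
  have hle : MeasurableSpace.comap (fun c : List ℕ → ℕ => c v) inferInstance ≤
    (inferInstance : MeasurableSpace (List ℕ → ℕ)) := (measurable_pi_apply v).comap_le
  have hmeas : Measurable[MeasurableSpace.comap (fun c : List ℕ → ℕ => c v) inferInstance]
      fun c => (c v : ENNReal) :=
    (measurable_of_countable (Nat.cast : ℕ → ENNReal)).comp (comap_measurable _)
  rw [lintegral_mul_eq_lintegral_mul_lintegral_of_independent_measurableSpace
    (generationFiltration.le n) hle h
    (@Measurable.indicator _ _ (_) _ _ _ _ (@measurable_one _ _ _ (_) _) hs) hmeas,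
    lintegral_indicator_one (generationFiltration.le n s hs)]
  congr 1
  rw [← lintegral_map (μ := offspringLaw ν) (f := fun n : ℕ => (n : ENNReal)) (by fun_prop)
    (measurable_pi_apply v), Measure.infinitePi_map_eval]

theorem setLIntegral_treeSize_succ (n : ℕ) {s : Set (List ℕ → ℕ)}
    (hs : MeasurableSet[generationFiltration n] s) :
    ∫⁻ c in s, treeSize (n + 1) c ∂offspringLaw ν =
      (∫⁻ c in s, treeSize n c ∂offspringLaw ν) * ∫⁻ n, (n : ENNReal) ∂ν := by
  classical
  have hs' := generationFiltration.le n s hs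
  have hm : ∀ v : {v : List ℕ // v.length = n},
      MeasurableSet[generationFiltration n] {c | MemOfOffspring c v} :=
    fun v => measurableSet_memOfOffspring v.2.le
  have hm' := fun v => generationFiltration.le n _ (hm v)
  simp_rw [treeSize_succ_eq_tsum, treeSize_eq_tsum]
  rw [lintegral_tsum, lintegral_tsum, ← ENNReal.tsum_mul_right]
  · refine tsum_congr fun v => ?_
    have h := lintegral_mem_mul ν v.2 (@MeasurableSet.inter _ (_) _ _ hs (hm v))
    have h1 : ∀ c : List ℕ → ℕ, (s ∩ {c | MemOfOffspring c v}).indicator 1 c * (c v : ENNReal) =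
        s.indicator (fun c => if MemOfOffspring c v then (c v : ENNReal) else 0) c := by
      intro c
      by_cases h1 : c ∈ s <;> by_cases h2 : MemOfOffspring c v <;> simp [Set.indicator, h1, h2]
    simp_rw [h1] at h
    rw [lintegral_indicator hs'] at h
    rw [h]
    congr 1
    have h2 : (fun c : List ℕ → ℕ => if MemOfOffspring c v then (1 : ENNReal) else 0) =
        {c | MemOfOffspring c v}.indicator 1 := by
      ext c; simp [Set.indicator]
    rw [h2, lintegral_indicator_one (hm' v), Measure.restrict_apply (hm' v), Set.inter_comm]
  · exact fun v => (Measurable.ite (hm' v) measurable_const measurable_const).aemeasurable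
  · refine fun v => (Measurable.ite (hm' v) ?_ measurable_const).aemeasurable
    exact (measurable_of_countable (Nat.cast : ℕ → ENNReal)).comp (measurable_pi_apply _)

theorem lintegral_treeSize (n : ℕ) :
    ∫⁻ c, treeSize n c ∂offspringLaw ν = (∫⁻ n, (n : ENNReal) ∂ν) ^ n := by
  induction n with
  | zero => simp [treeSize_zero]
  | succ n ih =>
    have := setLIntegral_treeSize_succ ν n (@MeasurableSet.univ _ (generationFiltration n))
    rw [Measure.restrict_univ] at this
    rw [this, ih, pow_succ]

theorem integrable_treeSize (hν : Integrable (fun n : ℕ => (n : ℝ)) ν) (n : ℕ) :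
    Integrable (fun c => (treeSize n c : ℝ)) (offspringLaw ν) := by
  refine ⟨(measurable_treeSize_real n).aestronglyMeasurable, ?_⟩
  rw [hasFiniteIntegral_iff_ofReal (ae_of_all _ fun c => by positivity)]
  simp only [ENNReal.ofReal_natCast]
  rw [lintegral_treeSize, lintegral_natCast ν hν]
  exact ENNReal.pow_lt_top ENNReal.ofReal_lt_top

theorem setIntegral_treeSize (s : Set (List ℕ → ℕ)) (n : ℕ) :
    ∫ c in s, (treeSize n c : ℝ) ∂offspringLaw ν =
      (∫⁻ c in s, treeSize n c ∂offspringLaw ν).toReal := by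
  rw [integral_eq_lintegral_of_nonneg_ae (ae_of_all _ fun c => by positivity)
    (measurable_treeSize_real n).aestronglyMeasurable]
  simp only [ENNReal.ofReal_natCast]

variable {ν}

theorem integral_normalizedSize (hν : Integrable (fun n : ℕ => (n : ℝ)) ν)
    (ha : 0 < meanOffspring ν) (n : ℕ) : ∫ c, normalizedSize ν n c ∂offspringLaw ν = 1 := by
  have h := setIntegral_treeSize ν Set.univ n
  rw [Measure.restrict_univ, lintegral_treeSize, lintegral_natCast ν hν, ENNReal.toReal_pow,
    ENNReal.toReal_ofReal ha.le] at h
  simp_rw [normalizedSize, integral_div, h]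
  exact div_self (pow_pos ha n).ne'

theorem submartingale_normalizedSize (hν : Integrable (fun n : ℕ => (n : ℝ)) ν)
    (ha : 0 < meanOffspring ν) :
    Submartingale (normalizedSize ν) generationFiltration (offspringLaw ν) := by
  refine submartingale_of_setIntegral_le_succ ?_ (fun n => (integrable_treeSize ν hν n).div_const _)
    fun n s hs => le_of_eq ?_
  · intro n
    exact (@Measurable.div_const _ _ _ _ _ (_) _ (measurable_treeSize_real_generationFiltration n)
      _).stronglyMeasurable
  · simp_rw [normalizedSize, integral_div, setIntegral_treeSize,
      setLIntegral_treeSize_succ ν n hs, lintegral_natCast ν hν, ENNReal.toReal_mul,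
      ENNReal.toReal_ofReal ha.le]
    rw [pow_succ, mul_div_mul_right _ _ ha.ne']

theorem ae_tendsto_limitSize (hν : Integrable (fun n : ℕ => (n : ℝ)) ν)
    (ha : 0 < meanOffspring ν) :
    ∀ᵐ c ∂offspringLaw ν,
      Tendsto (fun n => normalizedSize ν n c) atTop (𝓝 (limitSize ν c)) := by
  have h := (submartingale_normalizedSize hν ha).exists_ae_tendsto_of_bdd (R := 1) fun n => by
    rw [eLpNorm_one_eq_lintegral_enorm]
    simp_rw [Real.enorm_of_nonneg (normalizedSize_nonneg ν n _)]
    have hint : Integrable (normalizedSize ν n) (offspringLaw ν) :=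
      (integrable_treeSize ν hν n).div_const _
    rw [← ofReal_integral_eq_lintegral_ofReal hint (ae_of_all _ fun c => normalizedSize_nonneg ν n c),
      integral_normalizedSize hν ha]
    simp
  filter_upwards [h] with c hc
  exact tendsto_nhds_limUnder hc

theorem ae_limitSize_nonneg (hν : Integrable (fun n : ℕ => (n : ℝ)) ν)
    (ha : 0 < meanOffspring ν) : ∀ᵐ c ∂offspringLaw ν, 0 ≤ limitSize ν c := by
  filter_upwards [ae_tendsto_limitSize hν ha] with c hc
  exact ge_of_tendsto' hc fun n => normalizedSize_nonneg ν n c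

/-- The limit inherits the branching recursion of the generation sizes. -/
theorem ae_limitSize_eq (hν : Integrable (fun n : ℕ => (n : ℝ)) ν) (ha : 0 < meanOffspring ν) :
    ∀ᵐ c ∂offspringLaw ν, limitSize ν c =
      (∑ i ∈ Finset.range (c []), limitSize ν (subOffspring i c)) / meanOffspring ν := by
  have hsub : ∀ᵐ c ∂offspringLaw ν, ∀ i, Tendsto (fun n => normalizedSize ν n (subOffspring i c))
      atTop (𝓝 (limitSize ν (subOffspring i c))) :=
    ae_all_iff.2 fun i => (measurePreserving_subOffspring ν i).quasiMeasurePreserving.ae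
      (ae_tendsto_limitSize hν ha)
  filter_upwards [ae_tendsto_limitSize hν ha, hsub] with c hc hsub
  refine tendsto_nhds_unique (hc.comp (tendsto_add_atTop_nat 1)) ?_
  simp only [Function.comp_def, normalizedSize_succ]
  exact (tendsto_finsetSum _ fun i _ => hsub i).div_const _

end GaltonWatson

/-! ### The `N log N` condition -/

namespace GaltonWatson

open PlaneTree

section Analysis

theorem one_sub_pow_le_quadratic {x : ℝ} (hx0 : 0 ≤ x) (hx1 : x ≤ 1) (j : ℕ) :
    (1 - x) ^ j ≤ 1 - j * x + (j * x) ^ 2 := by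
  induction j with
  | zero => simp
  | succ j ih =>
    have h := mul_le_mul_of_nonneg_right ih (sub_nonneg.2 hx1)
    rw [pow_succ]
    push_cast
    have h1 : 0 ≤ (j : ℝ) ^ 2 * x ^ 3 := by positivity
    have h2 : 0 ≤ (j : ℝ) * x ^ 2 := by positivity
    nlinarith [sq_nonneg x]

/-- For `0 ≤ x ≤ y` the linear approximation `j * x` of `1 - (1 - x) ^ j` is accurate up to `x`
times a factor which depends on `y` only. -/
theorem le_one_sub_one_sub_pow {x y : ℝ} (hx0 : 0 ≤ x) (hx1 : x ≤ 1) (hxy : x ≤ y) (j : ℕ) :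
    x * (j - min (j : ℝ) (j ^ 2 * y)) ≤ 1 - (1 - x) ^ j := by
  have h1 : (1 - x) ^ j ≤ 1 := pow_le_one₀ (sub_nonneg.2 hx1) (by linarith)
  have h2 := one_sub_pow_le_quadratic hx0 hx1 j
  rcases min_cases (j : ℝ) (j ^ 2 * y) with ⟨h, -⟩ | ⟨h, -⟩ <;> rw [h]
  · simpa using h1
  · have h3 : (j : ℝ) ^ 2 * x * x ≤ j ^ 2 * y * x := by gcongr
    nlinarith

/-- The terms with `a ^ k < j` are about `log j / log a` many and bounded by `j`; the others
form a geometric series. -/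
theorem sum_min_le {a : ℝ} (ha : 1 < a) (j M : ℕ) :
    ∑ k ∈ Finset.range M, min (j : ℝ) (j ^ 2 * (a⁻¹) ^ k) ≤
      (Real.log a)⁻¹ * (j * Real.log j) + (1 + (1 - a⁻¹)⁻¹) * j := by
  have ha0 : 0 < a := zero_lt_one.trans ha
  have hr1 : a⁻¹ < 1 := inv_lt_one_of_one_lt₀ ha
  have hlog : 0 < Real.log a := Real.log_pos ha
  have hnn : ∀ k : ℕ, 0 ≤ min (j : ℝ) (j ^ 2 * (a⁻¹) ^ k) := fun k => by positivity
  rcases Nat.eq_zero_or_pos j with rfl | hj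
  · simp
  have hj' : (1 : ℝ) ≤ j := by exact_mod_cast hj
  have hlogj : 0 ≤ Real.log j := Real.log_nonneg hj'
  -- `K` is minimal with `j ≤ a ^ K`.
  set K := ⌈Real.log j / Real.log a⌉₊ with hK
  have hK1 : (K : ℝ) ≤ Real.log j / Real.log a + 1 := (Nat.ceil_lt_add_one (by positivity)).le
  have hK2 : (j : ℝ) * (a⁻¹) ^ K ≤ 1 := by
    rw [inv_pow, ← div_eq_mul_inv, div_le_one (by positivity),
      ← Real.log_le_log_iff (by positivity) (by positivity), Real.log_pow, ← div_le_iff₀ hlog]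
    exact Nat.le_ceil _
  calc ∑ k ∈ Finset.range M, min (j : ℝ) (j ^ 2 * (a⁻¹) ^ k)
      ≤ ∑ k ∈ Finset.range (K + M), min (j : ℝ) (j ^ 2 * (a⁻¹) ^ k) :=
        Finset.sum_le_sum_of_subset_of_nonneg (by simp) fun k _ _ => hnn k
    _ = ∑ k ∈ Finset.range K, min (j : ℝ) (j ^ 2 * (a⁻¹) ^ k) +
          ∑ k ∈ Finset.range M, min (j : ℝ) (j ^ 2 * (a⁻¹) ^ (K + k)) :=
        Finset.sum_range_add _ _ _
    _ ≤ ∑ k ∈ Finset.range K, (j : ℝ) + ∑ k ∈ Finset.range M, j * (a⁻¹) ^ k := by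
        gcongr with k _ k _
        · exact min_le_left _ _
        · refine (min_le_right _ _).trans ?_
          rw [pow_add]
          calc (j : ℝ) ^ 2 * (a⁻¹ ^ K * a⁻¹ ^ k) = (j * a⁻¹ ^ K) * (j * a⁻¹ ^ k) := by ring
            _ ≤ 1 * (j * a⁻¹ ^ k) := by gcongr
            _ = _ := one_mul _
    _ ≤ (Real.log j / Real.log a + 1) * j + j * (1 - a⁻¹)⁻¹ := by
        rw [Finset.sum_const, Finset.card_range, nsmul_eq_mul, ← Finset.mul_sum]
        gcongr
        have := (summable_geometric_of_lt_one (by positivity) hr1).sum_le_tsum (Finset.range M)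
          fun k _ => by positivity
        rwa [tsum_geometric_of_lt_one (by positivity) hr1] at this
    _ = _ := by field_simp; ring

end Analysis

variable {ν : Measure ℕ}

/-- The mean error in the linear approximation of `1 - (1 - x) ^ N` for `x ≤ y`,
relative to `x`. -/
noncomputable def linearizationError (ν : Measure ℕ) (y : ℝ) : ℝ :=
  ∫ j, min (j : ℝ) (j ^ 2 * y) ∂ν

theorem integrable_min_natCast (hν : Integrable (fun n : ℕ => (n : ℝ)) ν) {y : ℝ} (hy : 0 ≤ y) :
    Integrable (fun j : ℕ => min (j : ℝ) (j ^ 2 * y)) ν := by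
  refine hν.mono' (by fun_prop) (ae_of_all _ fun j => ?_)
  rw [Real.norm_of_nonneg (by positivity)]
  exact min_le_left _ _

theorem linearizationError_nonneg {y : ℝ} (hy : 0 ≤ y) : 0 ≤ linearizationError ν y :=
  integral_nonneg fun j => by positivity

theorem exp_neg_mul_normalizedSize_le_one {s : ℝ} (hs : 0 ≤ s) (n : ℕ) (c : List ℕ → ℕ) :
    Real.exp (-(s * normalizedSize ν n c)) ≤ 1 := by
  rw [Real.exp_le_one_iff, neg_nonpos]
  exact mul_nonneg hs (normalizedSize_nonneg ν n c)

variable [IsProbabilityMeasure ν]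

/-- The `N log N` condition implies a finite mean, since `log n ≥ 1` for `n ≥ 3`. -/
theorem integrable_natCast_of_mul_log
    (hν : Integrable (fun n : ℕ => (n : ℝ) * Real.log n) ν) :
    Integrable (fun n : ℕ => (n : ℝ)) ν := by
  refine (hν.add (integrable_const 3)).mono' (by fun_prop) (ae_of_all _ fun n => ?_)
  rw [Real.norm_of_nonneg (by positivity)]
  simp only [Pi.add_apply]
  rcases lt_or_ge n 3 with h | h
  · have h1 : (n : ℝ) ≤ 3 := by exact_mod_cast h.le
    have h2 : 0 ≤ (n : ℝ) * Real.log n := by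
      have := Real.log_natCast_nonneg n
      positivity
    linarith
  · have h1 : (3 : ℝ) ≤ n := by exact_mod_cast h
    have h2 : 1 ≤ Real.log n := by
      rw [Real.le_log_iff_exp_le (by linarith)]
      exact (Real.exp_one_lt_d9.le.trans (by norm_num)).trans h1
    nlinarith

theorem summable_linearizationError (hν : Integrable (fun n : ℕ => (n : ℝ) * Real.log n) ν)
    {a : ℝ} (ha : 1 < a) : Summable fun k : ℕ => linearizationError ν ((a⁻¹) ^ k) := by
  have hν1 := integrable_natCast_of_mul_log hν
  have ha0 : 0 < a := zero_lt_one.trans ha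
  refine summable_of_sum_range_le
    (c := ∫ j : ℕ, (Real.log a)⁻¹ * (j * Real.log j) + (1 + (1 - a⁻¹)⁻¹) * j ∂ν)
    (fun k => linearizationError_nonneg (by positivity)) fun M => ?_
  simp only [linearizationError]
  rw [← integral_finsetSum _ fun k _ => integrable_min_natCast hν1 (by positivity)]
  exact integral_mono (integrable_finsetSum _ fun k _ => integrable_min_natCast hν1 (by positivity))
    ((hν.const_mul _).add (hν1.const_mul _)) fun j => sum_min_le ha j M

theorem integral_prod_subtreesLaw (u : (List ℕ → ℕ) → ℝ) (hu : Measurable u) (j : ℕ) :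
    ∫ y, ∏ i ∈ Finset.range j, u (y i) ∂subtreesLaw ν = (∫ c, u c ∂offspringLaw ν) ^ j := by
  have hind : iIndepFun (fun (i : ℕ) (y : ℕ → List ℕ → ℕ) => u (y i)) (subtreesLaw ν) :=
    iIndepFun_infinitePi (X := fun _ => u) (fun _ => hu)
  have h := (hind.precomp (g := fun i : Fin j => (i : ℕ)) Fin.val_injective
    ).integral_fun_prod_eq_prod_integral
      fun i => (hu.comp (measurable_pi_apply _)).aestronglyMeasurable
  simp_rw [Finset.prod_range]
  refine h.trans ?_
  have h1 : ∀ i : ℕ, ∫ y, u (y i) ∂subtreesLaw ν = ∫ c, u c ∂offspringLaw ν := by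
    intro i
    have := (measurePreserving_eval_infinitePi (fun _ : ℕ => offspringLaw ν) i).map_eq
    conv_rhs => rw [← this]
    rw [integral_map (measurable_pi_apply i).aemeasurable hu.aestronglyMeasurable]
  simp only [h1, Finset.prod_const, Finset.card_univ, Fintype.card_fin]

/-- The expectation of a product over the children of the root is the generating function of the
offspring law, evaluated at the expectation of a factor. -/
theorem integral_prod_subOffspring {u : (List ℕ → ℕ) → ℝ} (hu : Measurable u)
    (hu0 : ∀ c, 0 ≤ u c) (hu1 : ∀ c, u c ≤ 1) :
    ∫ c, ∏ i ∈ Finset.range (c []), u (subOffspring i c) ∂offspringLaw ν =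
      ∫ j, (∫ c, u c ∂offspringLaw ν) ^ j ∂ν := by
  have hmeas : Measurable fun p : ℕ × (ℕ → List ℕ → ℕ) =>
      ∏ i ∈ Finset.range p.1, u (p.2 i) := by
    refine measurable_from_prod_countable_right fun j => ?_
    exact Finset.measurable_fun_prod (Finset.range j) fun i _ => hu.comp (measurable_pi_apply i)
  have hmp := measurePreserving_root_subOffspring ν
  have h := integral_map (μ := offspringLaw ν) hmp.measurable.aemeasurable
    hmeas.aestronglyMeasurable
  rw [hmp.map_eq] at h
  rw [← h, integral_prod]
  · exact integral_congr_ae (ae_of_all _ fun j => integral_prod_subtreesLaw u hu j)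
  · refine Integrable.of_bound hmeas.aestronglyMeasurable 1 (ae_of_all _ fun p => ?_)
    rw [Real.norm_of_nonneg (Finset.prod_nonneg fun i _ => hu0 _)]
    exact Finset.prod_le_one (fun i _ => hu0 _) fun i _ => hu1 _

/-- The Laplace transform of the normalized size of generation `n`. -/
noncomputable def laplace (ν : Measure ℕ) [IsProbabilityMeasure ν] (n : ℕ) (s : ℝ) : ℝ :=
  ∫ c, Real.exp (-(s * normalizedSize ν n c)) ∂offspringLaw ν

theorem integrable_exp_normalizedSize {s : ℝ} (hs : 0 ≤ s) (n : ℕ) :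
    Integrable (fun c => Real.exp (-(s * normalizedSize ν n c))) (offspringLaw ν) := by
  refine Integrable.of_bound (Measurable.aestronglyMeasurable (by fun_prop)) 1
    (ae_of_all _ fun c => ?_)
  rw [Real.norm_of_nonneg (Real.exp_nonneg _)]
  exact exp_neg_mul_normalizedSize_le_one hs n c

theorem laplace_nonneg (n : ℕ) (s : ℝ) : 0 ≤ laplace ν n s :=
  integral_nonneg fun _ => Real.exp_nonneg _

theorem laplace_le_one {s : ℝ} (hs : 0 ≤ s) (n : ℕ) : laplace ν n s ≤ 1 := by
  have := integral_mono (μ := offspringLaw ν) (integrable_exp_normalizedSize hs n)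
    (integrable_const 1) fun c => exp_neg_mul_normalizedSize_le_one hs n c
  simpa [laplace] using this

theorem laplace_zero (s : ℝ) : laplace ν 0 s = Real.exp (-s) := by
  simp [laplace, normalizedSize, treeSize_zero]

theorem one_sub_laplace_le (hν : Integrable (fun n : ℕ => (n : ℝ)) ν) (ha : 0 < meanOffspring ν)
    {s : ℝ} (hs : 0 ≤ s) (n : ℕ) : 1 - laplace ν n s ≤ s := by
  have hint : Integrable (normalizedSize ν n) (offspringLaw ν) :=
    (integrable_treeSize ν hν n).div_const _
  have := integral_mono (μ := offspringLaw ν) ((integrable_const 1).sub (hint.const_mul s))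
    (integrable_exp_normalizedSize hs n) fun c => by
      simpa [sub_eq_add_neg, add_comm] using Real.add_one_le_exp (-(s * normalizedSize ν n c))
  rw [integral_sub' (integrable_const 1) (hint.const_mul s), integral_const_mul,
    integral_normalizedSize hν ha] at this
  simp only [integral_const, probReal_univ, smul_eq_mul, mul_one] at this
  rw [laplace]
  linarith

theorem laplace_succ {s : ℝ} (hs : 0 ≤ s) (n : ℕ) :
    laplace ν (n + 1) s = ∫ j, laplace ν n (s / meanOffspring ν) ^ j ∂ν := by
  have hs' : 0 ≤ s / meanOffspring ν := div_nonneg hs (meanOffspring_nonneg ν)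
  have h := integral_prod_subOffspring (ν := ν)
    (u := fun c => Real.exp (-(s / meanOffspring ν * normalizedSize ν n c))) (by fun_prop)
    (fun _ => Real.exp_nonneg _) (exp_neg_mul_normalizedSize_le_one hs' n)
  rw [laplace]
  simp only [laplace]
  rw [← h]
  refine integral_congr_ae (ae_of_all _ fun c => ?_)
  simp only [normalizedSize_succ, ← Real.exp_sum]
  congr 1
  rw [Finset.sum_neg_distrib, ← Finset.mul_sum]
  ring

/-- One step of the recursion for the difference quotients of the Laplace transforms at `0`. -/
theorem one_sub_laplace_succ_ge (hν : Integrable (fun n : ℕ => (n : ℝ)) ν)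
    (ha : 0 < meanOffspring ν) {s : ℝ} (hs : 0 ≤ s) (n : ℕ) :
    (1 - laplace ν n (s / meanOffspring ν)) *
        (meanOffspring ν - linearizationError ν (s / meanOffspring ν)) ≤
      1 - laplace ν (n + 1) s := by
  have hs' : 0 ≤ s / meanOffspring ν := div_nonneg hs ha.le
  set φ := laplace ν n (s / meanOffspring ν) with hφ
  have hφ0 : 0 ≤ φ := laplace_nonneg _ _
  have hφ1 : φ ≤ 1 := laplace_le_one hs' n
  have hφs : 1 - φ ≤ s / meanOffspring ν := one_sub_laplace_le hν ha hs' n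
  have hpow : Integrable (fun j : ℕ => φ ^ j) ν :=
    Integrable.of_bound (by fun_prop) 1 (ae_of_all _ fun j => by
      rw [Real.norm_of_nonneg (by positivity)]; exact pow_le_one₀ hφ0 hφ1)
  have hmin := integrable_min_natCast hν hs'
  have h := integral_mono (μ := ν) ((hν.sub hmin).const_mul (1 - φ))
    ((integrable_const 1).sub hpow) fun j => by
      simpa using le_one_sub_one_sub_pow (sub_nonneg.2 hφ1) (by linarith) hφs j
  rw [integral_const_mul, integral_sub' hν hmin, integral_sub' (integrable_const 1) hpow] at h
  simp only [integral_const, probReal_univ, smul_eq_mul, mul_one] at h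
  rw [laplace_succ hs n]
  exact h

/-- The losses of `one_sub_laplace_succ_ge`, added up along the recursion that leads from
generation `n` at `a⁻¹ ^ k` to generation `0` at `a⁻¹ ^ (k + n)`. -/
theorem laplace_quotient_ge (hν : Integrable (fun n : ℕ => (n : ℝ)) ν)
    (ha : 1 < meanOffspring ν) (n k : ℕ) :
    1 / 2 - (∑ i ∈ Finset.range n, linearizationError ν ((meanOffspring ν)⁻¹ ^ (k + 1 + i))) /
        meanOffspring ν ≤
      meanOffspring ν ^ k * (1 - laplace ν n ((meanOffspring ν)⁻¹ ^ k)) := by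
  set a := meanOffspring ν with hadef
  have ha0 : 0 < a := zero_lt_one.trans ha
  induction n generalizing k with
  | zero =>
    -- For `0 ≤ t ≤ 1` one has `1 - exp (-t) ≥ t / (1 + t) ≥ t / 2`.
    set t := a⁻¹ ^ k with ht
    have ht0 : 0 < t := by positivity
    have ht1 : t ≤ 1 := pow_le_one₀ (by positivity) (inv_le_one_of_one_le₀ ha.le)
    have hat : a ^ k * t = 1 := by rw [ht, ← mul_pow, mul_inv_cancel₀ ha0.ne', one_pow]
    have hexp : Real.exp (-t) ≤ (1 + t)⁻¹ := by
      rw [Real.exp_neg]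
      exact inv_anti₀ (by positivity) (by linarith [Real.add_one_le_exp t])
    have h2 : t / 2 ≤ 1 - Real.exp (-t) := by
      have : t / 2 ≤ 1 - (1 + t)⁻¹ := by
        rw [div_le_iff₀ two_pos, ← sub_nonneg]
        have : (1 - (1 + t)⁻¹) * 2 - t = t * (1 - t) / (1 + t) := by field_simp; ring
        rw [this]
        exact div_nonneg (mul_nonneg ht0.le (by linarith)) (by positivity)
      linarith
    have h3 := mul_le_mul_of_nonneg_left h2 (pow_nonneg ha0.le k)
    rw [laplace_zero]
    simp only [Finset.range_zero, Finset.sum_empty, zero_div, sub_zero]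
    linarith
  | succ n ih =>
    have hst : a⁻¹ ^ k / a = a⁻¹ ^ (k + 1) := by rw [pow_succ, div_eq_mul_inv]
    have h1 := one_sub_laplace_succ_ge hν ha0 (s := a⁻¹ ^ k) (by positivity) n
    have h2 := one_sub_laplace_le hν ha0 (s := a⁻¹ ^ (k + 1)) (by positivity) n
    have h3 := ih (k + 1)
    rw [← hadef, hst] at h1
    set x := 1 - laplace ν n (a⁻¹ ^ (k + 1))
    set e := linearizationError ν (a⁻¹ ^ (k + 1))
    have he : 0 ≤ e := linearizationError_nonneg (by positivity)
    have hx : a ^ (k + 1) * x ≤ 1 := by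
      calc a ^ (k + 1) * x ≤ a ^ (k + 1) * a⁻¹ ^ (k + 1) := by gcongr
        _ = 1 := by rw [← mul_pow, mul_inv_cancel₀ ha0.ne', one_pow]
    have h4 := mul_le_mul_of_nonneg_left h1 (pow_nonneg ha0.le k)
    have h5 : a ^ k * (x * (a - e)) = a ^ (k + 1) * x - (a ^ (k + 1) * x) * (e / a) := by
      field_simp; ring
    have h6 : (a ^ (k + 1) * x) * (e / a) ≤ e / a :=
      mul_le_of_le_one_left (by positivity) hx
    rw [Finset.sum_range_succ', add_div]
    have h7 : ∀ i, k + 1 + 1 + i = k + 1 + (i + 1) := fun i => by ring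
    simp only [h7] at h3
    rw [add_zero]
    linarith

/-- Under the `N log N` condition the limit of the normalized generation sizes does not vanish
identically: the difference quotients at `0` of the Laplace transforms stay away from `0`. -/
theorem not_ae_limitSize_eq_zero (hν : Integrable (fun n : ℕ => (n : ℝ) * Real.log n) ν)
    (ha : 1 < meanOffspring ν) : ¬ ∀ᵐ c ∂offspringLaw ν, limitSize ν c = 0 := by
  intro h0
  have hν1 := integrable_natCast_of_mul_log hν
  have ha0 : 0 < meanOffspring ν := zero_lt_one.trans ha
  have hsum := summable_linearizationError hν ha
  obtain ⟨k, hk⟩ : ∃ k : ℕ, ∑' i, linearizationError ν ((meanOffspring ν)⁻¹ ^ (i + (k + 1))) <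
      1 / 4 := by
    have := (tendsto_sum_nat_add fun k : ℕ => linearizationError ν ((meanOffspring ν)⁻¹ ^ k)).comp
      (tendsto_add_atTop_nat 1)
    exact (this.eventually (gt_mem_nhds (by norm_num))).exists
  set t := (meanOffspring ν)⁻¹ ^ k with ht
  have ht0 : 0 < t := by positivity
  have hbound : ∀ n, laplace ν n t ≤ 1 - t / 4 := by
    intro n
    have h1 := laplace_quotient_ge hν1 ha n k
    have h2 : ∑ i ∈ Finset.range n, linearizationError ν ((meanOffspring ν)⁻¹ ^ (k + 1 + i)) ≤
        1 / 4 := by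
      refine le_trans ?_ hk.le
      simp_rw [add_comm (k + 1)]
      exact ((summable_nat_add_iff (k + 1)).2 hsum).sum_le_tsum _
        fun i _ => linearizationError_nonneg (by positivity)
    have h3 : (∑ i ∈ Finset.range n, linearizationError ν ((meanOffspring ν)⁻¹ ^ (k + 1 + i))) /
        meanOffspring ν ≤ 1 / 4 := by
      rw [div_le_iff₀ ha0]; linarith
    have h4 : t * (meanOffspring ν ^ k * (1 - laplace ν n t)) = 1 - laplace ν n t := by
      rw [← mul_assoc, ht, ← mul_pow, inv_mul_cancel₀ ha0.ne', one_pow, one_mul]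
    have h5 : t * (1 / 4) ≤ t * (meanOffspring ν ^ k * (1 - laplace ν n t)) := by
      gcongr; linarith
    linarith
  have hlim : Tendsto (fun n => laplace ν n t) atTop (𝓝 (∫ _, 1 ∂offspringLaw ν)) := by
    refine tendsto_integral_of_dominated_convergence (fun _ => 1)
      (fun n => (integrable_exp_normalizedSize ht0.le n).aestronglyMeasurable)
      (integrable_const 1) (fun n => ae_of_all _ fun c => ?_) ?_
    · rw [Real.norm_of_nonneg (Real.exp_nonneg _)]
      exact exp_neg_mul_normalizedSize_le_one ht0.le n c
    · filter_upwards [h0, ae_tendsto_limitSize hν1 ha0] with c hc hc'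
      rw [hc] at hc'
      have := (Real.continuous_exp.tendsto _).comp (hc'.const_mul t).neg
      simpa [Function.comp_def] using this
  have := le_of_tendsto' hlim hbound
  simp at this
  linarith

end GaltonWatson

/-! ### Behaviour of the limit at zero -/

namespace GaltonWatson

open PlaneTree

variable {ν : Measure ℕ}

theorem ae_minOffspring_le : ∀ᵐ n ∂ν, minOffspring ν ≤ n :=
  ae_iff_of_countable.2 fun _ hn => Nat.sInf_le (pos_iff_ne_zero.2 hn)

theorem measurableSet_sum_limitSize_lt (s : Finset ℕ) (x : ℝ) :
    MeasurableSet {y : ℕ → List ℕ → ℕ | ∑ i ∈ s, limitSize ν (y i) < x} := by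
  refine measurableSet_lt (Finset.measurable_fun_sum _ fun i _ => ?_) measurable_const
  exact (measurable_limitSize ν).comp (measurable_pi_apply i)

theorem measurableSet_limitSize_lt (x : ℝ) : MeasurableSet {c | limitSize ν c < x} :=
  measurableSet_lt (measurable_limitSize ν) measurable_const

/-- If `X` is unlikely to lie in `B` given that `w X` is small, the same holds given that
`w X + S` is small, for every nonnegative `S` independent of `X`. -/
theorem measure_mem_and_add_lt_le {Ω α : Type*} [MeasurableSpace Ω] [MeasurableSpace α]
    {μ : Measure Ω} [IsProbabilityMeasure μ] {X : Ω → α} {S : Ω → ℝ} (hX : Measurable X)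
    (hS : Measurable S) (hXS : IndepFun X S μ) (hS0 : ∀ᵐ ω ∂μ, 0 ≤ S ω) {w : α → ℝ}
    (hw : Measurable w) {B : Set α} (hB : MeasurableSet B) {δ : ENNReal} {x₀ : ℝ}
    (h : ∀ x ≤ x₀, μ.map X {b | b ∈ B ∧ w b < x} ≤ δ * μ.map X {b | w b < x}) {x : ℝ}
    (hx : x ≤ x₀) :
    μ {ω | X ω ∈ B ∧ w (X ω) + S ω < x} ≤ δ * μ {ω | w (X ω) + S ω < x} := by
  have := Measure.isProbabilityMeasure_map (μ := μ) hX.aemeasurable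
  have := Measure.isProbabilityMeasure_map (μ := μ) hS.aemeasurable
  have hprod := (indepFun_iff_map_prod_eq_prod_map_map hX.aemeasurable hS.aemeasurable).1 hXS
  have hmp : MeasurePreserving (fun ω => (X ω, S ω)) μ ((μ.map X).prod (μ.map S)) :=
    ⟨hX.prodMk hS, hprod⟩
  have hE : MeasurableSet {p : α × ℝ | w p.1 + p.2 < x} :=
    measurableSet_lt ((hw.comp measurable_fst).add measurable_snd) measurable_const
  have hBE : MeasurableSet {p : α × ℝ | p.1 ∈ B ∧ w p.1 + p.2 < x} :=
    (measurable_fst hB).inter hE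
  have h1 : μ {ω | X ω ∈ B ∧ w (X ω) + S ω < x} = _ :=
    hmp.measure_preimage hBE.nullMeasurableSet
  have h2 : μ {ω | w (X ω) + S ω < x} = _ := hmp.measure_preimage hE.nullMeasurableSet
  rw [h1, h2, Measure.prod_apply_symm hBE, Measure.prod_apply_symm hE,
    ← lintegral_const_mul _ (measurable_measure_prodMk_right hE)]
  refine lintegral_mono_ae ?_
  rw [ae_map_iff hS.aemeasurable
    (measurableSet_le (measurable_measure_prodMk_right hBE)
      ((measurable_measure_prodMk_right hE).const_mul δ))]
  filter_upwards [hS0] with ω hω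
  have h3 := h (x - S ω) (by linarith)
  simp only [lt_sub_iff_add_lt] at h3
  exact h3

variable [IsProbabilityMeasure ν]

theorem measure_singleton_minOffspring_ne_zero : ν {minOffspring ν} ≠ 0 := by
  refine (Nat.sInf_mem (s := {n : ℕ | 0 < ν {n}}) ?_).ne'
  by_contra h
  have h0 : ∀ n, ν {n} = 0 := fun n => by
    by_contra hn
    exact h ⟨n, pos_iff_ne_zero.2 hn⟩
  have : ∀ᵐ n ∂ν, False := ae_iff_of_countable.2 fun n hn => hn (h0 n)
  simp at this
  exact IsProbabilityMeasure.ne_zero ν this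

theorem minOffspring_pos (h0 : ν {0} = 0) : 0 < minOffspring ν := by
  rw [Nat.pos_iff_ne_zero]
  intro h
  have := measure_singleton_minOffspring_ne_zero (ν := ν)
  rw [h] at this
  exact this h0

theorem not_ae_eq (hnd : ∀ n : ℕ, ν {n} ≠ 1) (n : ℕ) : ¬ ∀ᵐ j ∂ν, j = n := fun h =>
  hnd n ((mem_ae_iff_prob_eq_one (measurableSet_singleton n)).1 h)

theorem minOffspring_lt_meanOffspring (hν : Integrable (fun n : ℕ => (n : ℝ)) ν)
    (hnd : ∀ n : ℕ, ν {n} ≠ 1) : (minOffspring ν : ℝ) < meanOffspring ν := by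
  by_contra! hle
  have hint : Integrable (fun n : ℕ => (n : ℝ) - minOffspring ν) ν :=
    hν.sub (integrable_const (minOffspring ν : ℝ))
  have hnn : 0 ≤ᵐ[ν] fun n : ℕ => (n : ℝ) - minOffspring ν := by
    filter_upwards [ae_minOffspring_le (ν := ν)] with n hn
    simpa using hn
  have h0 : ∫ n : ℕ, ((n : ℝ) - minOffspring ν) ∂ν = 0 := by
    refine le_antisymm ?_ (integral_nonneg_of_ae hnn)
    rw [integral_sub hν (integrable_const (minOffspring ν : ℝ)), ← meanOffspring]
    simpa using hle
  rw [integral_eq_zero_iff_of_nonneg_ae hnn hint] at h0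
  refine not_ae_eq hnd (minOffspring ν) ?_
  filter_upwards [h0] with n hn
  simpa [sub_eq_zero] using hn

/-- The limit does not vanish: the probability `q` that it does is a fixed point of the generating
function of the offspring law, and `q < 1` by the `N log N` condition. -/
theorem ae_limitSize_pos (h0 : ν {0} = 0) (hnd : ∀ n : ℕ, ν {n} ≠ 1)
    (hν : Integrable (fun n : ℕ => (n : ℝ) * Real.log n) ν) (ha : 1 < meanOffspring ν) :
    ∀ᵐ c ∂offspringLaw ν, 0 < limitSize ν c := by
  have hν1 := integrable_natCast_of_mul_log hν
  have ha0 : 0 < meanOffspring ν := zero_lt_one.trans ha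
  set A : Set (List ℕ → ℕ) := {c | limitSize ν c = 0} with hA
  have hAm : MeasurableSet A := measurable_limitSize ν (measurableSet_singleton 0)
  set q := (offspringLaw ν).real A with hq
  have hq0 : 0 ≤ q := measureReal_nonneg
  have hq1 : q < 1 := by
    refine lt_of_le_of_ne measureReal_le_one fun h => not_ae_limitSize_eq_zero hν ha ?_
    rw [hq, measureReal_def, ENNReal.toReal_eq_one_iff] at h
    exact (mem_ae_iff_prob_eq_one hAm).2 h
  have hfix : q = ∫ j, q ^ j ∂ν := by
    have h := integral_prod_subOffspring (ν := ν) (u := A.indicator 1)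
      (measurable_one.indicator hAm) (fun c => Set.indicator_nonneg (fun _ _ => zero_le_one) c)
      (fun c => Set.indicator_le_self' (f := 1) (fun _ _ => zero_le_one) c)
    rw [integral_indicator_one hAm] at h
    rw [hq, ← h, ← integral_indicator_one hAm]
    have hsub : ∀ᵐ c ∂offspringLaw ν, ∀ i, 0 ≤ limitSize ν (subOffspring i c) :=
      ae_all_iff.2 fun i => (measurePreserving_subOffspring ν i).quasiMeasurePreserving.ae
        (ae_limitSize_nonneg hν1 ha0)
    refine integral_congr_ae ?_
    filter_upwards [ae_limitSize_eq hν1 ha0, hsub] with c hc hsub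
    have hiff : c ∈ A ↔ ∀ i ∈ Finset.range (c []), subOffspring i c ∈ A := by
      rw [hA, Set.mem_ofPred_eq, hc, div_eq_zero_iff, or_iff_left ha0.ne',
        Finset.sum_eq_zero_iff_of_nonneg fun i _ => hsub i]
      rfl
    by_cases hcA : c ∈ A
    · rw [Set.indicator_of_mem hcA, Finset.prod_eq_one fun i hi =>
        Set.indicator_of_mem (hiff.1 hcA i hi) 1]
      rfl
    · rw [Set.indicator_of_notMem hcA]
      rw [hiff] at hcA
      push Not at hcA
      obtain ⟨i, hi, hiA⟩ := hcA
      rw [Finset.prod_eq_zero hi (Set.indicator_of_notMem hiA 1)]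
  have hqz : q = 0 := by
    by_contra hne
    have hqpos : 0 < q := lt_of_le_of_ne hq0 (Ne.symm hne)
    have hpow : Integrable (fun j : ℕ => q ^ j) ν :=
      Integrable.of_bound (by fun_prop) 1 (ae_of_all _ fun j => by
        rw [Real.norm_of_nonneg (by positivity)]; exact pow_le_one₀ hq0 hq1.le)
    have hnn : 0 ≤ᵐ[ν] fun j : ℕ => q - q ^ j := by
      filter_upwards [ae_minOffspring_le (ν := ν)] with j hj
      have : j ≠ 0 := ((minOffspring_pos h0).trans_le hj).ne'
      simpa using pow_le_of_le_one hq0 hq1.le this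
    have hz : ∫ j : ℕ, (q - q ^ j) ∂ν = 0 := by
      rw [integral_sub (integrable_const q) hpow, ← hfix]
      simp
    rw [integral_eq_zero_iff_of_nonneg_ae hnn ((integrable_const q).sub hpow)] at hz
    refine not_ae_eq hnd 1 ?_
    filter_upwards [hz] with j hj
    refine pow_right_injective₀ hqpos hq1.ne ?_
    have hj' : q - q ^ j = 0 := hj
    simp only [pow_one]
    linarith
  rw [hq, measureReal_eq_zero_iff] at hqz
  filter_upwards [ae_limitSize_nonneg hν1 ha0, measure_eq_zero_iff_ae_notMem.1 hqz] with c h1 h2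
  exact lt_of_le_of_ne h1 (Ne.symm h2)

theorem measure_root_inter (j : ℕ) {D : Set (ℕ → List ℕ → ℕ)} (hD : MeasurableSet D) :
    offspringLaw ν {c | c [] = j ∧ (fun i => subOffspring i c) ∈ D} =
      ν {j} * subtreesLaw ν D := by
  rw [← Measure.prod_prod, ← (measurePreserving_root_subOffspring ν).measure_preimage
    ((measurableSet_singleton j).prod hD).nullMeasurableSet]
  rfl

theorem measure_subOffspring_mem {D : Set (ℕ → List ℕ → ℕ)} (hD : MeasurableSet D) :
    offspringLaw ν {c | (fun i => subOffspring i c) ∈ D} = subtreesLaw ν D := by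
  rw [← map_subOffspring, Measure.map_apply (by fun_prop) hD]
  rfl

/-- The event that the root has `m` children, which carry small limits, is part of the event
that the limit is small. -/
theorem measure_sum_lt_le (hν : Integrable (fun n : ℕ => (n : ℝ)) ν) (ha : 0 < meanOffspring ν)
    (m : ℕ) (x : ℝ) :
    ν {m} * subtreesLaw ν
        {y | ∑ i ∈ Finset.range m, limitSize ν (y i) < meanOffspring ν * x} ≤
      offspringLaw ν {c | limitSize ν c < x} := by
  rw [← measure_root_inter m (measurableSet_sum_limitSize_lt _ _)]
  refine measure_mono_ae ?_
  filter_upwards [ae_limitSize_eq hν ha] with c hc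
  rintro ⟨h1, h2⟩
  change limitSize ν c < x
  rw [hc, h1, div_lt_iff₀' ha]
  exact h2

/-- Small values of the limit have positive probability: otherwise, as all children of the
root may have limits below `a * x / m`, the same would hold at `a / m * x`, hence at
all levels. -/
theorem measure_limitSize_lt_pos (h0 : ν {0} = 0) (hnd : ∀ n : ℕ, ν {n} ≠ 1)
    (hν : Integrable (fun n : ℕ => (n : ℝ)) ν) {x : ℝ} (hx : 0 < x) :
    0 < offspringLaw ν {c | limitSize ν c < x} := by
  set m := minOffspring ν with hm
  have hm0 : 0 < m := minOffspring_pos h0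
  have hm0' : (0 : ℝ) < m := by exact_mod_cast hm0
  have hma : (m : ℝ) < meanOffspring ν := minOffspring_lt_meanOffspring hν hnd
  have ha : 0 < meanOffspring ν := hm0'.trans hma
  rw [pos_iff_ne_zero]
  intro hzero
  have hstep : ∀ z : ℝ, offspringLaw ν {c | limitSize ν c < z} = 0 →
      offspringLaw ν {c | limitSize ν c < meanOffspring ν / m * z} = 0 := by
    intro z hz
    have h1 := measure_sum_lt_le hν ha m z
    rw [hz, nonpos_iff_eq_zero, mul_eq_zero,
      or_iff_right measure_singleton_minOffspring_ne_zero] at h1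
    have h2 : (Set.pi (Finset.range m) fun _ => {c | limitSize ν c < meanOffspring ν / m * z}) ⊆
        {y | ∑ i ∈ Finset.range m, limitSize ν (y i) < meanOffspring ν * z} := by
      intro y hy
      have : ∑ i ∈ Finset.range m, limitSize ν (y i) <
          ∑ i ∈ Finset.range m, meanOffspring ν / m * z :=
        Finset.sum_lt_sum_of_nonempty (Finset.nonempty_range_iff.2 hm0.ne') fun i hi => hy i hi
      rw [Finset.sum_const, Finset.card_range, nsmul_eq_mul] at this
      rw [Set.mem_ofPred_eq]
      convert this using 1
      field_simp
    have h3 := measure_mono_null h2 h1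
    rw [Measure.infinitePi_pi _ fun _ _ => measurableSet_limitSize_lt _, Finset.prod_const,
      Finset.card_range] at h3
    exact eq_zero_of_pow_eq_zero h3
  have hall : ∀ k : ℕ,
      offspringLaw ν {c | limitSize ν c < (meanOffspring ν / m) ^ k * x} = 0 := by
    intro k
    induction k with
    | zero => simpa using hzero
    | succ k ih =>
      have := hstep _ ih
      rwa [← mul_assoc, ← pow_succ'] at this
  have hcover : (Set.univ : Set (List ℕ → ℕ)) ⊆
      ⋃ k : ℕ, {c | limitSize ν c < (meanOffspring ν / m) ^ k * x} := by
    intro c _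
    obtain ⟨k, hk⟩ := pow_unbounded_of_one_lt (limitSize ν c / x) ((one_lt_div hm0').2 hma)
    exact Set.mem_iUnion.2 ⟨k, (div_lt_iff₀ hx).1 hk⟩
  have := measure_mono_null hcover (measure_iUnion_null hall)
  simp at this

theorem exists_measure_limitSize_lt_le (hpos : ∀ᵐ c ∂offspringLaw ν, 0 < limitSize ν c)
    {δ : ENNReal} (hδ : δ ≠ 0) :
    ∃ x₀ > 0, ∀ x ≤ x₀, offspringLaw ν {c | limitSize ν c < x} ≤ δ := by
  have hanti : Antitone fun n : ℕ => {c | limitSize ν c < 1 / ((n : ℝ) + 1)} := by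
    intro n k hnk c (hc : limitSize ν c < 1 / ((k : ℝ) + 1))
    exact lt_of_lt_of_le hc (Nat.one_div_le_one_div hnk)
  have h := tendsto_measure_iInter_atTop (μ := offspringLaw ν)
    (fun n : ℕ => (measurableSet_limitSize_lt (ν := ν) (1 / ((n : ℝ) + 1))).nullMeasurableSet)
    hanti ⟨0, measure_ne_top _ _⟩
  have hnull : offspringLaw ν (⋂ n : ℕ, {c | limitSize ν c < 1 / ((n : ℝ) + 1)}) = 0 := by
    rw [measure_eq_zero_iff_ae_notMem]
    filter_upwards [hpos] with c hc hmem
    obtain ⟨n, hn⟩ := exists_nat_one_div_lt hc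
    exact lt_asymm hn (Set.mem_iInter.1 hmem n)
  rw [hnull] at h
  obtain ⟨n, hn⟩ := (h.eventually (gt_mem_nhds (pos_iff_ne_zero.2 hδ))).exists
  refine ⟨1 / ((n : ℝ) + 1), Nat.one_div_pos_of_nat, fun x hx => le_trans ?_ hn.le⟩
  exact measure_mono fun c hc => lt_of_lt_of_le hc hx

/-! ### Small limits force minimal offspring -/

/-- If more than `m` children were born, the sum of the limits of `m` of them and the limit of
a further one would be small, and these are independent. -/
theorem measure_root_ne_le (hν : Integrable (fun n : ℕ => (n : ℝ)) ν) (ha : 0 < meanOffspring ν)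
    (x : ℝ) :
    offspringLaw ν {c | c [] ≠ minOffspring ν ∧ limitSize ν c < x} ≤
      subtreesLaw ν {y | ∑ i ∈ Finset.range (minOffspring ν), limitSize ν (y i) <
          meanOffspring ν * x} *
        offspringLaw ν {c | limitSize ν c < meanOffspring ν * x} := by
  set m := minOffspring ν with hm
  set z := meanOffspring ν * x with hz
  have hind : iIndepFun (fun (i : ℕ) (y : ℕ → List ℕ → ℕ) => limitSize ν (y i)) (subtreesLaw ν) :=
    iIndepFun_infinitePi (X := fun _ => limitSize ν) (fun _ => measurable_limitSize ν)
  have h1 : IndepFun (fun y : ℕ → List ℕ → ℕ => ∑ i ∈ Finset.range m, limitSize ν (y i))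
      (fun y => limitSize ν (y m)) (subtreesLaw ν) := by
    have := hind.indepFun_finsetSum_of_notMem
      (fun i => (measurable_limitSize ν).comp (measurable_pi_apply i))
      (Finset.notMem_range_self (n := m))
    simpa [Finset.sum_fn] using this
  have h2 := h1.measure_inter_preimage_eq_mul _ _ (measurableSet_Iio (a := z))
    (measurableSet_Iio (a := z))
  have h3 : subtreesLaw ν ((fun y => limitSize ν (y m)) ⁻¹' Set.Iio z) =
      offspringLaw ν {c | limitSize ν c < z} :=
    (measurePreserving_eval_infinitePi (fun _ : ℕ => offspringLaw ν) m).measure_preimage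
      (measurableSet_limitSize_lt z).nullMeasurableSet
  have h4 : MeasurableSet ({y : ℕ → List ℕ → ℕ | ∑ i ∈ Finset.range m, limitSize ν (y i) < z} ∩
      {y | limitSize ν (y m) < z}) :=
    (measurableSet_sum_limitSize_lt _ _).inter
      (measurable_pi_apply (X := fun _ : ℕ => List ℕ → ℕ) m (measurableSet_limitSize_lt z))
  rw [h3] at h2
  refine le_trans ?_ h2.le
  change _ ≤ subtreesLaw ν ({y : ℕ → List ℕ → ℕ | ∑ i ∈ Finset.range m, limitSize ν (y i) < z} ∩
      {y | limitSize ν (y m) < z})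
  rw [← measure_subOffspring_mem h4]
  refine measure_mono_ae ?_
  have hroot : ∀ᵐ c ∂offspringLaw ν, m ≤ c [] :=
    (measurePreserving_eval_infinitePi (fun _ : List ℕ => ν) []).quasiMeasurePreserving.ae
      ae_minOffspring_le
  have hsub : ∀ᵐ c ∂offspringLaw ν, ∀ i, 0 ≤ limitSize ν (subOffspring i c) :=
    ae_all_iff.2 fun i => (measurePreserving_subOffspring ν i).quasiMeasurePreserving.ae
      (ae_limitSize_nonneg hν ha)
  filter_upwards [ae_limitSize_eq hν ha, hroot, hsub] with c hc hroot hsub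
  rintro ⟨hne, hlt⟩
  rw [hc, div_lt_iff₀' ha, ← hz] at hlt
  have hlt' : ∑ i ∈ Finset.range (m + 1), limitSize ν (subOffspring i c) < z := by
    refine lt_of_le_of_lt (Finset.sum_le_sum_of_subset_of_nonneg ?_ fun i _ _ => hsub i) hlt
    exact Finset.range_subset_range.2 (lt_of_le_of_ne hroot (Ne.symm hne))
  rw [Finset.sum_range_succ] at hlt'
  have hs : 0 ≤ ∑ i ∈ Finset.range m, limitSize ν (subOffspring i c) :=
    Finset.sum_nonneg fun i _ => hsub i
  exact ⟨by simp only [Set.mem_ofPred_eq]; linarith [hsub m],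
    by simp only [Set.mem_ofPred_eq]; linarith⟩

theorem measurable_ofOffspring : Measurable ofOffspring := continuous_ofOffspring.measurable

theorem measurableSet_regularUpTo (m k : ℕ) : MeasurableSet {c | RegularUpTo m k c} := by
  have : {c | RegularUpTo m k c} =
      ofOffspring ⁻¹' Metric.closedBall (regular m) (Real.exp (-(k : ℝ))) := by
    ext c
    exact (dist_le_exp_iff k).symm
  rw [this]
  exact measurable_ofOffspring measurableSet_closedBall

/-- The induction step for a single subtree: the limits of the other subtrees play the role of the
independent summand in `measure_mem_and_add_lt_le`. -/
theorem measure_not_regularUpTo_sum_le (hν : Integrable (fun n : ℕ => (n : ℝ)) ν)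
    (ha : 0 < meanOffspring ν) {k m i : ℕ} (hi : i ∈ Finset.range m) {δ : ENNReal} {x₀ : ℝ}
    (h : ∀ x ≤ x₀, offspringLaw ν {c | ¬ RegularUpTo m k c ∧ limitSize ν c < x} ≤
      δ * offspringLaw ν {c | limitSize ν c < x}) {x : ℝ} (hx : x ≤ x₀) :
    subtreesLaw ν {y | ¬ RegularUpTo m k (y i) ∧
        ∑ l ∈ Finset.range m, limitSize ν (y l) < x} ≤
      δ * subtreesLaw ν {y | ∑ l ∈ Finset.range m, limitSize ν (y l) < x} := by
  have hmap := (measurePreserving_eval_infinitePi (fun _ : ℕ => offspringLaw ν) i).map_eq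
  have hmeas : ∀ l : ℕ, Measurable fun y : ℕ → List ℕ → ℕ => limitSize ν (y l) :=
    fun l => (measurable_limitSize ν).comp (measurable_pi_apply l)
  have hind : iIndepFun (fun (l : ℕ) (y : ℕ → List ℕ → ℕ) => y l) (subtreesLaw ν) :=
    iIndepFun_infinitePi (X := fun _ c => c) (fun _ => measurable_id)
  have hXS : IndepFun (fun y : ℕ → List ℕ → ℕ => y i)
      (fun y => ∑ l ∈ (Finset.range m).erase i, limitSize ν (y l)) (subtreesLaw ν) := by
    have h1 := hind.indepFun_finset {i} ((Finset.range m).erase i) (by simp)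
      fun l => measurable_pi_apply l
    have h2 := h1.comp (φ := fun z : ({i} : Finset ℕ) → List ℕ → ℕ => z ⟨i, by simp⟩)
      (ψ := fun z : ((Finset.range m).erase i : Finset ℕ) → List ℕ → ℕ =>
        ∑ l, limitSize ν (z l)) 
      (measurable_pi_apply (X := fun _ : ({i} : Finset ℕ) => List ℕ → ℕ) ⟨i, by simp⟩)
      (Finset.measurable_fun_sum _ fun l _ =>
        (measurable_limitSize ν).comp (measurable_pi_apply l))
    have h3 : (fun y : ℕ → List ℕ → ℕ => ∑ l ∈ (Finset.range m).erase i, limitSize ν (y l)) =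
        fun y => ∑ l : ((Finset.range m).erase i : Finset ℕ), limitSize ν (y l) := funext fun y =>
      (Finset.sum_coe_sort ((Finset.range m).erase i) fun l => limitSize ν (y l)).symm
    rw [h3]
    exact h2
  have hS0 : ∀ᵐ y ∂subtreesLaw ν, 0 ≤ ∑ l ∈ (Finset.range m).erase i, limitSize ν (y l) := by
    have : ∀ᵐ y ∂subtreesLaw ν, ∀ l, 0 ≤ limitSize ν (y l) := ae_all_iff.2 fun l =>
      (measurePreserving_eval_infinitePi (fun _ : ℕ => offspringLaw ν) l
        ).quasiMeasurePreserving.ae (ae_limitSize_nonneg hν ha)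
    filter_upwards [this] with y hy
    exact Finset.sum_nonneg fun l _ => hy l
  have hmain := measure_mem_and_add_lt_le (μ := subtreesLaw ν) (measurable_pi_apply i)
    (Finset.measurable_fun_sum _ fun l _ => hmeas l) hXS hS0 (measurable_limitSize ν)
    (measurableSet_regularUpTo m k).compl (δ := δ) (x₀ := x₀) (by
      intro x hx
      have := h x hx
      rw [← hmap] at this
      exact this) hx
  have hsum : ∀ y : ℕ → List ℕ → ℕ, limitSize ν (y i) +
      ∑ l ∈ (Finset.range m).erase i, limitSize ν (y l) = ∑ l ∈ Finset.range m, limitSize ν (y l) :=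
    fun y => Finset.add_sum_erase _ (fun l => limitSize ν (y l)) hi
  simp only [hsum] at hmain
  exact hmain

/-- Given that the limit is small, the tree is likely to be regular up to generation `k`. -/
theorem exists_measure_not_regularUpTo_le (hν : Integrable (fun n : ℕ => (n : ℝ)) ν)
    (ha : 0 < meanOffspring ν) (hpos : ∀ᵐ c ∂offspringLaw ν, 0 < limitSize ν c) (k : ℕ)
    {δ : ENNReal} (hδ : δ ≠ 0) :
    ∃ x₀ > 0, ∀ x ≤ x₀,
      offspringLaw ν {c | ¬ RegularUpTo (minOffspring ν) k c ∧ limitSize ν c < x} ≤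
        δ * offspringLaw ν {c | limitSize ν c < x} := by
  set m := minOffspring ν with hm
  have hνm : ν {m} ≠ 0 := measure_singleton_minOffspring_ne_zero
  induction k generalizing δ with
  | zero =>
    refine ⟨1, one_pos, fun x _ => ?_⟩
    simp [regularUpTo_zero]
  | succ k ih =>
    have hδ2 : δ / 2 ≠ 0 := (ENNReal.half_pos hδ).ne'
    obtain ⟨x₁, hx₁, h₁⟩ := exists_measure_limitSize_lt_le hpos (mul_ne_zero hδ2 hνm)
    obtain ⟨x₂, hx₂, h₂⟩ := ih (δ := δ / 2 / m)
      (ENNReal.div_ne_zero.2 ⟨hδ2, ENNReal.natCast_ne_top m⟩)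
    refine ⟨min x₁ x₂ / meanOffspring ν, by positivity, fun x hx => ?_⟩
    rw [le_div_iff₀' ha] at hx
    set z := meanOffspring ν * x with hz
    set F := offspringLaw ν {c | limitSize ν c < x} with hF
    set G := subtreesLaw ν {y | ∑ i ∈ Finset.range m, limitSize ν (y i) < z} with hG
    have hGF : ν {m} * G ≤ F := measure_sum_lt_le hν ha m x
    have hroot : offspringLaw ν {c | c [] ≠ m ∧ limitSize ν c < x} ≤ δ / 2 * F := by
      calc offspringLaw ν {c | c [] ≠ m ∧ limitSize ν c < x}
          ≤ G * offspringLaw ν {c | limitSize ν c < z} := measure_root_ne_le hν ha x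
        _ ≤ G * (δ / 2 * ν {m}) := by gcongr; exact h₁ z (hx.trans (min_le_left _ _))
        _ = δ / 2 * (ν {m} * G) := by ring
        _ ≤ δ / 2 * F := by gcongr
    set D : ℕ → Set (ℕ → List ℕ → ℕ) := fun i =>
      {y | ¬ RegularUpTo m k (y i) ∧ ∑ l ∈ Finset.range m, limitSize ν (y l) < z} with hDdef
    have hD : ∀ i, MeasurableSet (D i) := fun i =>
      MeasurableSet.inter (measurable_pi_apply (X := fun _ : ℕ => List ℕ → ℕ) i
        (measurableSet_regularUpTo m k).compl)
        (measurableSet_sum_limitSize_lt _ _)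
    have hchild : ∀ i ∈ Finset.range m,
        offspringLaw ν {c | c [] = m ∧ (fun i => subOffspring i c) ∈ D i} ≤ δ / 2 / m * F := by
      intro i hi
      rw [measure_root_inter m (hD i)]
      calc ν {m} * subtreesLaw ν (D i) ≤ ν {m} * (δ / 2 / m * G) := by
            gcongr
            exact measure_not_regularUpTo_sum_le hν ha hi h₂ (hx.trans (min_le_right _ _))
        _ = δ / 2 / m * (ν {m} * G) := by ring
        _ ≤ δ / 2 / m * F := by gcongr
    have hcover : offspringLaw ν {c | ¬ RegularUpTo m (k + 1) c ∧ limitSize ν c < x} ≤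
        offspringLaw ν ({c | c [] ≠ m ∧ limitSize ν c < x} ∪
          ⋃ i ∈ Finset.range m, {c | c [] = m ∧ (fun i => subOffspring i c) ∈ D i}) := by
      refine measure_mono_ae ?_
      filter_upwards [ae_limitSize_eq hν ha] with c hc
      rintro ⟨hreg, hlt⟩
      by_cases hcm : c [] = m
      · right
        obtain ⟨i, hi, hireg⟩ : ∃ i < m, ¬ RegularUpTo m k (subOffspring i c) := by
          by_contra! hall
          exact hreg (RegularUpTo.succ hcm hall)
        refine Set.mem_iUnion₂.2 ⟨i, Finset.mem_range.2 hi, hcm, hireg, ?_⟩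
        rw [hc, hcm, div_lt_iff₀' ha] at hlt
        exact hlt
      · exact Or.inl ⟨hcm, hlt⟩
    calc offspringLaw ν {c | ¬ RegularUpTo m (k + 1) c ∧ limitSize ν c < x}
        ≤ δ / 2 * F + ∑ i ∈ Finset.range m, δ / 2 / m * F :=
          hcover.trans ((measure_union_le _ _).trans (add_le_add hroot
            ((measure_biUnion_finset_le _ _).trans (Finset.sum_le_sum hchild))))
      _ ≤ δ / 2 * F + δ / 2 * F := by
          rw [Finset.sum_const, Finset.card_range, nsmul_eq_mul, ← mul_assoc]
          gcongr
          exact ENNReal.mul_div_le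
      _ = δ * F := by rw [← add_mul, ENNReal.add_halves]

end GaltonWatson

/-! ### Convergence of the conditional laws -/

namespace GaltonWatson

open PlaneTree

variable {ν : Measure ℕ} [IsProbabilityMeasure ν]

theorem tendsto_cond_regularUpTo (h0 : ν {0} = 0) (hnd : ∀ n : ℕ, ν {n} ≠ 1)
    (hν : Integrable (fun n : ℕ => (n : ℝ) * Real.log n) ν) (k : ℕ) :
    Tendsto (fun ε : ℝ => cond (offspringLaw ν) {c | limitSize ν c < ε}
      {c | RegularUpTo (minOffspring ν) k c}) (𝓝[>] 0) (𝓝 1) := by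
  have hν1 := integrable_natCast_of_mul_log hν
  have ha : 1 < meanOffspring ν :=
    lt_of_le_of_lt (by exact_mod_cast minOffspring_pos h0) (minOffspring_lt_meanOffspring hν1 hnd)
  have hzero : Tendsto (fun ε : ℝ => cond (offspringLaw ν) {c | limitSize ν c < ε}
      {c | RegularUpTo (minOffspring ν) k c}ᶜ) (𝓝[>] 0) (𝓝 0) := by
    rw [ENNReal.tendsto_nhds_zero]
    intro δ hδ
    obtain ⟨x₀, hx₀, h⟩ := exists_measure_not_regularUpTo_le hν1 (zero_lt_one.trans ha)
      (ae_limitSize_pos h0 hnd hν ha) k hδ.ne'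
    filter_upwards [Ioc_mem_nhdsGT hx₀] with ε hε
    have hpos := measure_limitSize_lt_pos h0 hnd hν1 hε.1
    have h1 := h ε hε.2
    rw [cond_apply (measurableSet_limitSize_lt ε), Set.inter_comm, mul_comm, ← div_eq_mul_inv]
    exact ENNReal.div_le_of_le_mul h1
  have h1 := ENNReal.Tendsto.sub (tendsto_const_nhds (x := (1 : ENNReal))) hzero
    (Or.inl ENNReal.one_ne_top)
  rw [tsub_zero] at h1
  refine h1.congr' ?_
  filter_upwards [self_mem_nhdsWithin] with ε hε
  have := cond_isProbabilityMeasure (measure_limitSize_lt_pos h0 hnd hν1 hε).ne'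
  rw [prob_compl_eq_one_sub (measurableSet_regularUpTo _ k),
    ENNReal.sub_sub_cancel ENNReal.one_ne_top prob_le_one]

/-- Reduction of an arbitrary offspring family to the canonical one. -/
theorem measurePreserving_offspring {Ω : Type*} [MeasurableSpace Ω] {P : Measure Ω}
    {ξ : List ℕ → Ω → ℕ} (hξ_meas : ∀ v, Measurable (ξ v)) (hξ_law : ∀ v, P.map (ξ v) = ν)
    (hξ_indep : iIndepFun ξ P) :
    MeasurePreserving (fun ω v => ξ v ω) P (offspringLaw ν) := by
  refine ⟨measurable_pi_lambda _ hξ_meas, ?_⟩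
  rw [hξ_indep.map_fun_eq_infinitePi_map hξ_meas]
  simp_rw [hξ_law]

end GaltonWatson

open GaltonWatson PlaneTree in
theorem corollary1 {Ω : Type*} [MeasurableSpace Ω] (P : Measure Ω) [IsProbabilityMeasure P]
    (ν : Measure ℕ) [IsProbabilityMeasure ν]
    (hν_zero : ν {0} = 0)
    (hν_nondeg : ∀ n : ℕ, ν {n} ≠ 1)
    (hν_log : Integrable (fun n : ℕ => (n : ℝ) * Real.log (n : ℝ)) ν)
    (ξ : List ℕ → Ω → ℕ)
    (hξ_meas : ∀ v, Measurable (ξ v))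
    (hξ_law : ∀ v, P.map (ξ v) = ν)
    (hξ_indep : iIndepFun ξ P) :
    (∀ᵐ ω ∂P, Tendsto (fun n : ℕ =>
        (GaltonWatson.Z ξ n ω : ℝ) / GaltonWatson.meanOffspring ν ^ n)
        atTop (𝓝 (GaltonWatson.W ν ξ ω))) ∧
    (∀ ε : ℝ, 0 < ε → 0 < P {ω | GaltonWatson.W ν ξ ω < ε}) ∧
    (∃ L : ℝ → ProbabilityMeasure PlaneTree,
      (∀ ε : ℝ, 0 < ε → (L ε : Measure PlaneTree) =
        (cond P {ω | GaltonWatson.W ν ξ ω < ε}).map (GaltonWatson.tree ξ)) ∧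
      Tendsto L (𝓝[>] (0 : ℝ))
        (𝓝 (diracProba (PlaneTree.regular (GaltonWatson.minOffspring ν))))) ∧
    (∀ k : ℕ, Tendsto (fun ε : ℝ =>
        (cond P {ω | GaltonWatson.W ν ξ ω < ε}).real
          {ω | GaltonWatson.Z ξ k ω = GaltonWatson.minOffspring ν ^ k})
        (𝓝[>] (0 : ℝ)) (𝓝 1)) := by
  have hν1 := integrable_natCast_of_mul_log hν_log
  have ha : 0 < meanOffspring ν :=
    lt_of_le_of_lt (Nat.cast_nonneg _) (minOffspring_lt_meanOffspring hν1 hν_nondeg)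
  have hmp := measurePreserving_offspring hξ_meas hξ_law hξ_indep
  have hW : ∀ ε, MeasurableSet {ω | W ν ξ ω < ε} := fun ε =>
    hmp.measurable (measurableSet_limitSize_lt ε)
  have hpos : ∀ ε : ℝ, 0 < ε → 0 < P {ω | W ν ξ ω < ε} := fun ε hε => by
    have := measure_limitSize_lt_pos hν_zero hν_nondeg hν1 hε
    rwa [← hmp.measure_preimage (measurableSet_limitSize_lt ε).nullMeasurableSet] at this
  have htree : Measurable (tree ξ) := measurable_ofOffspring.comp hmp.measurable
  have hprob : ∀ ε : ℝ, 0 < ε → IsProbabilityMeasure (cond P {ω | W ν ξ ω < ε}) :=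
    fun ε hε => cond_isProbabilityMeasure (hpos ε hε).ne'
  have hreg : ∀ k, Tendsto (fun ε : ℝ => cond P {ω | W ν ξ ω < ε}
      {ω | RegularUpTo (minOffspring ν) k fun v => ξ v ω}) (𝓝[>] 0) (𝓝 1) := by
    intro k
    refine (tendsto_cond_regularUpTo hν_zero hν_nondeg hν_log k).congr fun ε => ?_
    rw [cond_apply (hW ε), cond_apply (measurableSet_limitSize_lt ε),
      ← hmp.measure_preimage (measurableSet_limitSize_lt ε).nullMeasurableSet,
      ← hmp.measure_preimage ((measurableSet_limitSize_lt ε).inter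
        (measurableSet_regularUpTo _ k)).nullMeasurableSet]
    rfl
  refine ⟨hmp.quasiMeasurePreserving.ae (ae_tendsto_limitSize hν1 ha), hpos, ?_, fun k => ?_⟩
  · have hex : ∀ ε : ℝ, ∃ L : ProbabilityMeasure PlaneTree,
        0 < ε → (L : Measure PlaneTree) = (cond P {ω | W ν ξ ω < ε}).map (tree ξ) := by
      intro ε
      by_cases hε : 0 < ε
      · have := hprob ε hε
        exact ⟨⟨_, Measure.isProbabilityMeasure_map htree.aemeasurable⟩, fun _ => rfl⟩
      · exact ⟨diracProba (regular (minOffspring ν)), fun h => absurd h hε⟩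
    choose L hL using hex
    refine ⟨L, hL, ?_⟩
    refine tendsto_of_forall_isOpen_le_liminf' fun G hG => ?_
    by_cases hmem : regular (minOffspring ν) ∈ G
    · obtain ⟨r, hr, hball⟩ := Metric.isOpen_iff.1 hG _ hmem
      obtain ⟨k, hk⟩ : ∃ k : ℕ, Real.exp (-(k : ℝ)) < r :=
        ((Real.tendsto_exp_neg_atTop_nhds_zero.comp tendsto_natCast_atTop_atTop).eventually
          (gt_mem_nhds hr)).exists
      refine prob_le_one.trans ?_
      rw [← (hreg k).liminf_eq]
      refine liminf_le_liminf ?_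
      filter_upwards [self_mem_nhdsWithin] with ε hε
      rw [hL ε hε, Measure.map_apply htree hG.measurableSet]
      exact measure_mono fun ω hω => hball (((dist_le_exp_iff k).2 hω).trans_lt hk)
    · have : ((diracProba (regular (minOffspring ν)) : ProbabilityMeasure PlaneTree) :
          Measure PlaneTree) G = 0 := by
        change Measure.dirac _ G = 0
        rw [Measure.dirac_apply' _ hG.measurableSet, Set.indicator_of_notMem hmem]
      rw [this]
      exact zero_le
  · have h1 := (ENNReal.tendsto_toReal ENNReal.one_ne_top).comp (hreg k)
    rw [ENNReal.toReal_one] at h1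
    refine tendsto_of_tendsto_of_tendsto_of_le_of_le' h1 tendsto_const_nhds ?_ ?_
    · filter_upwards [self_mem_nhdsWithin] with ε hε
      have := hprob ε hε
      exact measureReal_mono fun ω hω => RegularUpTo.treeSize_eq hω
    · filter_upwards [self_mem_nhdsWithin] with ε hε
      have := hprob ε hε
      exact measureReal_le_one
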